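/- Let $G=\langle\sigma_1\rangle\times\cdots\times\langle\sigma_r\rangle$ be a noncyclic finite abelian group, $n_i=|\sigma_i|$, and let $F$ be a field on which $G$ acts by field automorphisms (not necessarily faithfully) such that $F^*$ is an $H^1$-trivial $G$-module, i.e. $H^1(H,F^*)=0$ for every subgroup $H\le G$. Let $A_2(G)$ be the kernel of the $\mathbb{Z}[G]$-linear map $\bigoplus_{i=1}^r\mathbb{Z}[G]d_i\to I[G]$, $d_i\mapsto\sigma_i-1$, where $I[G]\subseteq\mathbb{Z}[G]$ is the augmentation ideal. Let $L_0=F(A_2(G))$ be the field of fractions of the commutative group ring $F[A_2(G)]$ with the $G$-action induced by the actions on $F$ and on $A_2(G)$, let $K=L_0^G$, and let $e:A_2(G)\to L_0^*$ be the canonical map that writes the elements of $A_2(G)$ multiplicatively. Put $$b_i=\Big(\sum_{k=0}^{n_i-1}\sigma_i^k\Big)d_i,\qquad u_{ij}=(\sigma_i-1)d_j-(\sigma_j-1)d_i ,$$ which are elements of $A_2(G)$. The generic crossed product $\Delta'(G)=(L_0/K,z_\sigma,e(u),e(b))$ is the $K$-algebra generated by $L_0$ and elements $z_1,\dots,z_r$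 subject to the relations $$z_i x=\sigma_i(x)z_i\ (x\in L_0),\qquad z_iz_j=e(u_{ij})z_jz_i,\qquad z_i^{n_i}=e(b_i).$$ Then $\Delta'(G)$ is a central simple $K$-algebra of dimension $|G|^2$, and $$\exp(\Delta'(G))=\mathrm{ind}(\Delta'(G))=|G| .$$ Here $\exp$ is the order of the class of the algebra in the Brauer group of $K$ (the least $m\ge 1$ such that the $m$-th tensor power over $K$ is a matrix algebra over $K$), and $\mathrm{ind}$ is the degree $\sqrt{\dim_K D}$ of the division algebra $D$ such that the algebra is a matrix algebra over $D$. -/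

import Mathlib

open scoped TensorProduct

noncomputable section

namespace CrossedProd

universe u v w

/-! ### Finite abelian groups and their modules -/

/-- `G = ⟨σ₁⟩ × ⋯ × ⟨σ_r⟩` as an internal direct product: every element of `G` is in exactly one
way a product `x₁ ⋯ x_r` with `x_i` in the cyclic subgroup generated by `σ_i`. -/
def IsDirectProduct {G : Type u} [CommGroup G] {r : ℕ} (σ : Fin r → G) : Prop :=
  Function.Bijective
    (fun x : ((i : Fin r) → Subgroup.zpowers (σ i)) => ∏ i, ((x i : Subgroup.zpowers (σ i)) : G))

/-- A (multiplicatively written) `G`-module `M` is `H¹`-trivial if `H¹(H, M) = 0` for all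
subgroups `H ≤ G`, that is, if every `1`-cocycle `H → M` is a `1`-coboundary. -/
def IsH1Trivial (G : Type u) (M : Type v) [Group G] [CommGroup M] [MulDistribMulAction G M] :
    Prop :=
  ∀ (H : Subgroup G) (f : H → M),
    groupCohomology.IsMulCocycle₁ f → groupCohomology.IsMulCoboundary₁ f

/-- The multiplicative group `F^*` of a field `F` with a `G`-action is an `H¹`-trivial
`G`-module, for the action `(g x : F) = g (x : F)`. -/
def UnitsH1Trivial (G : Type u) (F : Type v) [Group G] [Field F] [MulSemiringAction G F] : Prop :=
  letI : MulDistribMulAction G Fˣ := Units.mulDistribMulActionRight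
  IsH1Trivial G Fˣ

/-! ### The lattice `A₂(G)` -/

section Lattice

variable {G : Type u} [CommGroup G] {r : ℕ} (σ : Fin r → G)

/-- The element `g - 1` of the integral group ring. -/
def subOne (g : G) : MonoidAlgebra ℤ G := MonoidAlgebra.of ℤ G g - 1

/-- The map `j : P₂(G) = ⨁ ℤ[G] d_i → ℤ[G]`, `d_i ↦ σ_i - 1`. Its values lie in the augmentation
ideal `I[G]`, so that its kernel is also the kernel of the map `P₂(G) → I[G]`. -/
def jMap : (Fin r → MonoidAlgebra ℤ G) →ₗ[MonoidAlgebra ℤ G] MonoidAlgebra ℤ G :=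
  ∑ i, (LinearMap.proj i).smulRight (subOne (σ i))

lemma jMap_apply (x : Fin r → MonoidAlgebra ℤ G) : jMap σ x = ∑ i, x i * subOne (σ i) := by
  simp [jMap]

/-- The `G`-lattice `A₂(G)`, the kernel of `j : P₂(G) → I[G]`. -/
abbrev A2 : Submodule (MonoidAlgebra ℤ G) (Fin r → MonoidAlgebra ℤ G) := LinearMap.ker (jMap σ)

/-- The basis element `d_i` of `P₂(G)`. -/
def dElt (r : ℕ) (i : Fin r) : Fin r → MonoidAlgebra ℤ G := Pi.single i 1

lemma jMap_dElt (i : Fin r) : jMap σ (dElt r i) = subOne (σ i) := by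
  classical
  simp [jMap_apply, dElt, Pi.single_apply, Finset.sum_ite_eq']

/-- `b_i = (1 + σ_i + ⋯ + σ_i ^ (n_i - 1)) d_i ∈ A₂(G)`, where `n_i` is the order of `σ_i`. -/
def bLat (i : Fin r) : A2 σ :=
  ⟨(∑ k ∈ Finset.range (orderOf (σ i)), MonoidAlgebra.of ℤ G (σ i ^ k)) • dElt r i, by
    rw [LinearMap.mem_ker, map_smul, jMap_dElt, smul_eq_mul, subOne]
    simp_rw [map_pow]
    rw [geom_sum_mul, ← map_pow, pow_orderOf_eq_one, map_one, sub_self]⟩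

/-- `u_ij = (σ_i - 1) d_j - (σ_j - 1) d_i ∈ A₂(G)`. -/
def uLat (i j : Fin r) : A2 σ :=
  ⟨subOne (σ i) • dElt r j - subOne (σ j) • dElt r i, by
    rw [LinearMap.mem_ker, map_sub, map_smul, map_smul, jMap_dElt, jMap_dElt, smul_eq_mul,
      smul_eq_mul, mul_comm, sub_self]⟩

/-- The action of `G` on `A₂(G)` by additive automorphisms: `g` acts as `g ∈ ℤ[G]`. -/
def latAct (g : G) : A2 σ ≃+ A2 σ where
  toFun := fun a => MonoidAlgebra.of ℤ G g • a
  invFun := fun a => MonoidAlgebra.of ℤ G g⁻¹ • a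
  left_inv := fun a => by
    beta_reduce
    rw [smul_smul, ← map_mul, inv_mul_cancel, map_one, one_smul]
  right_inv := fun a => by
    beta_reduce
    rw [smul_smul, ← map_mul, mul_inv_cancel, map_one, one_smul]
  map_add' := fun a b => smul_add _ a b

lemma latAct_apply (g : G) (a : A2 σ) : latAct σ g a = MonoidAlgebra.of ℤ G g • a := rfl

/-- Finite non-empty subsets of the free abelian group `A₂(G)` have unique sums; this makes the
group ring `F[A₂(G)]` a domain. -/
instance : UniqueSums (A2 σ) :=
  UniqueSums.of_injective_addHom
    (H := A2 σ) (G := Fin r → G → ℤ)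
    { toFun := fun a i g => ((a : Fin r → MonoidAlgebra ℤ G) i).coeff g
      map_add' := fun a b => by
        funext i g
        simp }
    (fun a b h => by
      apply Subtype.ext
      funext i
      apply MonoidAlgebra.coeff_injective
      ext g
      exact congrFun (congrFun h i) g) inferInstance

end Lattice

/-! ### The field `L₀ = F(A₂(G))` with its `G`-action -/

section GenericField

variable (F : Type v) [Field F] {G : Type u} [CommGroup G] {r : ℕ} (σ : Fin r → G)

/-- The field `L₀ = F(A₂(G))` of fractions of the commutative group ring `F[A₂(G)]`. -/
def L0 : Type (max u v) := FractionRing (AddMonoidAlgebra F (A2 σ))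

instance : Field (L0 F σ) := inferInstanceAs (Field (FractionRing (AddMonoidAlgebra F (A2 σ))))

instance : Algebra (AddMonoidAlgebra F (A2 σ)) (L0 F σ) :=
  inferInstanceAs (Algebra (AddMonoidAlgebra F (A2 σ))
    (FractionRing (AddMonoidAlgebra F (A2 σ))))

instance : IsFractionRing (AddMonoidAlgebra F (A2 σ)) (L0 F σ) :=
  inferInstanceAs (IsFractionRing (AddMonoidAlgebra F (A2 σ))
    (FractionRing (AddMonoidAlgebra F (A2 σ))))

/-- The canonical map `e` from `A₂(G)` to `F[A₂(G)] ⊆ L₀`, `a ↦ 1 · e(a)`. -/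
def e (a : A2 σ) : L0 F σ := algebraMap (AddMonoidAlgebra F (A2 σ)) (L0 F σ)
  (AddMonoidAlgebra.single a 1)

variable [MulSemiringAction G F]

/-- The action of `G` on the group ring: `g (∑ c_a e(a)) = ∑ (g c_a) e(g a)`. -/
def ringAct : G →* RingAut (AddMonoidAlgebra F (A2 σ)) where
  toFun g := (AddMonoidAlgebra.mapDomainRingEquiv F (latAct σ g)).trans
    (AddMonoidAlgebra.mapRingEquiv (A2 σ) (MulSemiringAction.toRingEquiv G F g))
  map_one' := by
    apply RingEquiv.toRingHom_injective
    apply AddMonoidAlgebra.ringHom_ext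
    · intro c
      simp
    · intro a
      simp [latAct_apply, ← MonoidAlgebra.one_def]
  map_mul' g h := by
    apply RingEquiv.toRingHom_injective
    apply AddMonoidAlgebra.ringHom_ext
    · intro c
      simp [RingAut.mul_apply]
    · intro a
      have key : MonoidAlgebra.of ℤ G (g * h) • a
          = MonoidAlgebra.of ℤ G g • MonoidAlgebra.of ℤ G h • a := by
        rw [map_mul, mul_smul]
      simpa [RingAut.mul_apply, latAct_apply] using
        congrArg (fun y => AddMonoidAlgebra.single y (1 : F)) key

lemma ringAct_single (g : G) (a : A2 σ) (c : F) :
    ringAct F σ g (AddMonoidAlgebra.single a c)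
      = AddMonoidAlgebra.single (MonoidAlgebra.of ℤ G g • a) (g • c) := by
  simp [ringAct, latAct_apply]

/-- The induced action of `G` on `L₀ = F(A₂(G))`. -/
instance : MulSemiringAction G (L0 F σ) :=
  MulSemiringAction.compHom (L0 F σ)
    ((IsFractionRing.ringEquivOfRingEquivHom (AddMonoidAlgebra F (A2 σ)) (L0 F σ)).comp
      (ringAct F σ))

lemma smul_algebraMap (g : G) (x : AddMonoidAlgebra F (A2 σ)) :
    g • algebraMap (AddMonoidAlgebra F (A2 σ)) (L0 F σ) x
      = algebraMap (AddMonoidAlgebra F (A2 σ)) (L0 F σ) (ringAct F σ g x) := by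
  exact IsFractionRing.ringEquivOfRingEquiv_algebraMap _ _

end GenericField

/-! ### Abelian crossed products -/

section AbelianCrossedProduct

variable {G : Type u} [CommGroup G] (L : Type v) [Field L] [MulSemiringAction G L] {r : ℕ}
  (σ : Fin r → G) (u : Fin r → Fin r → L) (b : Fin r → L)

/-- The defining relations of the abelian crossed product. The free generators are a symbol
`Sum.inl x` for every `x ∈ L` and the symbols `Sum.inr i` for `z_i`. -/
inductive Rel : FreeAlgebra (FixedPoints.subfield G L) (L ⊕ Fin r) →
    FreeAlgebra (FixedPoints.subfield G L) (L ⊕ Fin r) → Prop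
  /-- the symbols of the elements of `L` form an `L^G`-subalgebra that is an image of `L` -/
  | add (x y : L) : Rel (FreeAlgebra.ι _ (Sum.inl (x + y)))
      (FreeAlgebra.ι _ (Sum.inl x) + FreeAlgebra.ι _ (Sum.inl y))
  | mul (x y : L) : Rel (FreeAlgebra.ι _ (Sum.inl (x * y)))
      (FreeAlgebra.ι _ (Sum.inl x) * FreeAlgebra.ι _ (Sum.inl y))
  | scalar (k : FixedPoints.subfield G L) : Rel (FreeAlgebra.ι _ (Sum.inl (k : L)))
      (algebraMap _ _ k)
  /-- `z_i x = σ_i(x) z_i` -/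
  | conj (i : Fin r) (x : L) : Rel (FreeAlgebra.ι _ (Sum.inr i) * FreeAlgebra.ι _ (Sum.inl x))
      (FreeAlgebra.ι _ (Sum.inl (σ i • x)) * FreeAlgebra.ι _ (Sum.inr i))
  /-- `z_i z_j = u_ij z_j z_i` -/
  | comm (i j : Fin r) : Rel (FreeAlgebra.ι _ (Sum.inr i) * FreeAlgebra.ι _ (Sum.inr j))
      (FreeAlgebra.ι _ (Sum.inl (u i j)) *
        (FreeAlgebra.ι _ (Sum.inr j) * FreeAlgebra.ι _ (Sum.inr i)))
  /-- `z_i ^ n_i = b_i`, where `n_i` is the order of `σ_i` -/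
  | pow (i : Fin r) : Rel (FreeAlgebra.ι _ (Sum.inr i) ^ orderOf (σ i))
      (FreeAlgebra.ι _ (Sum.inl (b i)))

/-- The abelian crossed product `(L / L^G, z_σ, u, b)`: the `L^G`-algebra generated by `L` and
elements `z_1, …, z_r` subject to `z_i x = σ_i(x) z_i`, `z_i z_j = u_ij z_j z_i` and
`z_i ^ n_i = b_i`. -/
abbrev AbelianCrossedProduct : Type v := RingQuot (Rel L σ u b)

end AbelianCrossedProduct

/-- The generic crossed product `Δ'(G) = (L₀ / L₀^G, z_σ, e(u), e(b))`. -/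
abbrev GenericCrossedProduct (F : Type v) [Field F] {G : Type u} [CommGroup G]
    [MulSemiringAction G F] {r : ℕ} (σ : Fin r → G) : Type (max u v) :=
  AbelianCrossedProduct (L0 F σ) σ (fun i j => e F σ (uLat σ i j)) (fun i => e F σ (bLat σ i))

/-! ### Index and exponent of central simple algebras -/

section IndexExponent

variable (K : Type v) [Field K] (A : Type w) [Ring A] [Algebra K A]

/-- `A` is split: `A` is isomorphic to a matrix algebra over `K`. -/
def IsSplit : Prop :=
  ∃ k : ℕ, k ≠ 0 ∧ Nonempty (A ≃ₐ[K] Matrix (Fin k) (Fin k) K)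

/-- The exponent of the central simple `K`-algebra `A` is `m`: the order of the class of `A` in
the Brauer group of `K` is `m`, that is, `m` is the smallest positive integer such that the `m`-th
tensor power of `A` over `K` is split. -/
def HasExponent (m : ℕ) : Prop :=
  IsLeast {n : ℕ | 0 < n ∧ IsSplit K (⨂[K] _ : Fin n, A)} m

/-- The index of the central simple `K`-algebra `A` is `m`: `A` is a matrix algebra over a
(by Wedderburn unique) division algebra `D` with `dim_K D = m ^ 2`. -/
def HasIndex (m : ℕ) : Prop :=
  ∃ (D : Type w) (_ : DivisionRing D) (_ : Algebra K D) (k : ℕ), k ≠ 0 ∧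
    Nonempty (A ≃ₐ[K] Matrix (Fin k) (Fin k) D) ∧
    FiniteDimensional K D ∧ Module.finrank K D = m ^ 2

end IndexExponent

end CrossedProd

end

noncomputable section

namespace CrossedProd

universe u v w

/-! ### Semilinear actions of a finite group of automorphisms of a field -/

section Descent

variable {G : Type u} [Group G] [Finite G] {L : Type v} [Field L] [MulSemiringAction G L]

/-! Write $L=L_0$, $P_2=\bigoplus\mathbb Z[G]d_i$, and let $s(g)\in P_2$ lift $g-1$. Then
$t(g,h)=e(s(gh)-s(g)-g\,s(h))$ is a 2-cocycle in $L^*$, and everything depends on one fact: $t^m$ is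
a coboundary exactly when $|G|$ divides $m$. That $|G|$ suffices is an explicit cochain in the
lattice. For the converse (`card_dvd_of_isCobdry`, `card_dvd_of_latCochain`), factoriality of
$F[A_2(G)]$ and triviality of its units turn a trivialization of $t^m$ over $L$ into one in
$A_2(G)$. The cochain so obtained differs from $-ms$ by a crossed homomorphism into the permutation
module $P_2$, hence by some $g\mapsto(g-1)q$. Now $j(q)-m$ is invariant, so it is a multiple of the
norm element, and its augmentation $-m$ is a multiple of $|G|$.

The algebra acts on $L^G$ by matrices commuting with semilinear operators $T_g$ that satisfy
$T_gT_h=t(g,h)T_{gh}$. On a stable subspace of dimension $w$, determinants of the $T_g$ show that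
$t^w$ is a coboundary (`isCobdry_pow_finrank`). Kernels of algebra elements are stable, so they are
$0$ or everything: the algebra is a division algebra. Its dimension is $|G|^2$, because $|G|$ lines
over $L$ span it while its image spans all matrices over $L$; here $G$ acts faithfully on $L$ as it
is not cyclic.

On the $m$-th tensor power the operators have cocycle $t^m$. If $t^m$ is a coboundary they rescale
to a true action, and Galois descent splits the power; if the power splits, the image of a primitive
idempotent is a stable line and $t^m$ is a coboundary. -/

lemma span_range_orbit [FaithfulSMul G L] :
    Submodule.span L (Set.range fun (x : L) (g : G) => g • x) = ⊤ := by
  have := Fintype.ofFinite G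
  classical
  by_contra hne
  obtain ⟨f, hf0, hf⟩ := Submodule.exists_le_ker_of_lt_top _ (lt_top_iff_ne_top.2 hne)
  apply hf0
  -- Dedekind: faithfulness makes the elements of $G$ distinct characters, and a functional
  -- vanishing on all orbit vectors is a linear relation between them.
  have hli : LinearIndependent L (fun g : G => ((MulSemiringAction.toRingHom G L g : L →* L) :
      L → L)) := by
    refine (linearIndependent_monoidHom L L).comp
      (fun g : G => (MulSemiringAction.toRingHom G L g : L →* L)) ?_
    intro g h hgh
    exact FaithfulSMul.eq_of_smul_eq_smul (α := L) fun x => DFunLike.congr_fun hgh x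
  rw [Fintype.linearIndependent_iff] at hli
  have key : ∀ g, f (Pi.single g 1) = 0 := by
    apply hli
    funext x
    have h1 : f (fun g : G => g • x) = 0 := hf (Submodule.subset_span ⟨x, rfl⟩)
    rw [LinearMap.pi_apply_eq_sum_univ f] at h1
    rw [Finset.sum_apply, Pi.zero_apply, ← h1]
    refine Finset.sum_congr rfl fun g _ => ?_
    simp only [Pi.smul_apply, smul_eq_mul]
    rw [mul_comm]
    congr 2
    funext j
    simp [Pi.single_apply, eq_comm]
  refine LinearMap.pi_ext' fun g => LinearMap.ext_ring ?_
  simpa using key g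

open scoped Classical in
-- Orbit vectors span $L^G$, so in particular they reach the indicator of $1$. The coefficients
-- recover a vector from its traces.
lemma exists_orbit_dual [FaithfulSMul G L] :
    ∃ c : L →₀ L, ∀ g : G, (c.sum fun x a => a * g • x) = if g = 1 then 1 else 0 := by
  have h : (Pi.single 1 1 : G → L) ∈
      Submodule.span L (Set.range fun (x : L) (g : G) => g • x) := by
    rw [span_range_orbit]; trivial
  obtain ⟨c, hc⟩ := Finsupp.mem_span_range_iff_exists_finsupp.1 h
  refine ⟨c, fun g => ?_⟩
  have := congrFun hc g
  rw [Finsupp.sum, Finset.sum_apply, Pi.single_apply] at this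
  simpa [Finsupp.sum] using this

variable {V : Type w} [AddCommGroup V] [Module L V]

/-- Galois descent: the fixed vectors of a semilinear action span. -/
lemma span_fixed [FaithfulSMul G L] (T : G → V →+ V)
    (hT : ∀ g (x : L) v, T g (x • v) = (g • x) • T g v) (hmul : ∀ g h v, T g (T h v) = T (g * h) v)
    (hone : ∀ v, T 1 v = v) : Submodule.span L {v : V | ∀ g, T g v = v} = ⊤ := by
  classical
  have := Fintype.ofFinite G
  obtain ⟨c, hc⟩ := exists_orbit_dual (G := G) (L := L)
  rw [eq_top_iff]
  intro v _
  have hfix : ∀ x : L, (∑ h : G, T h (x • v)) ∈ {v : V | ∀ g, T g v = v} := by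
    intro x g
    rw [map_sum]
    simp_rw [hmul]
    exact Fintype.sum_equiv (Equiv.mulLeft g) _ _ fun h => rfl
  -- Exchanging sums, the coefficient of $T_h v$ is $\sum c_x\,h(x)$, which vanishes unless $h=1$.
  have hv : v = c.sum fun x a => a • ∑ h : G, T h (x • v) := by
    simp_rw [Finsupp.sum, Finset.smul_sum, hT, smul_smul]
    rw [Finset.sum_comm]
    simp_rw [← Finset.sum_smul]
    have : ∀ h : G, (∑ x ∈ c.support, c x * h • x) = if h = 1 then 1 else 0 := by
      intro h
      convert hc h
      rfl
    simp_rw [this, ite_smul, one_smul, zero_smul]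
    rw [Finset.sum_ite_eq' Finset.univ (1 : G)]
    simp [hone]
  rw [hv]
  exact Submodule.sum_mem _ fun x _ => Submodule.smul_mem _ _ (Submodule.subset_span (hfix x))

/-- A `2`-cochain with non-zero values in `L` is a coboundary. -/
def IsCobdry (t : G → G → L) : Prop :=
  ∃ a : G → L, (∀ g, a g ≠ 0) ∧ ∀ g h, a g * g • a h = t g h * a (g * h)

omit [Finite G] in
-- The matrices of the $T_g$ in a basis satisfy $D_g\cdot g(D_h)=t(g,h)D_{gh}$; their determinants
-- form the required cochain.
lemma isCobdry_pow_finrank [FiniteDimensional L V] {t : G → G → L} (ht : ∀ g h, t g h ≠ 0)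
    (T : G → V →+ V) (hT : ∀ g (x : L) v, T g (x • v) = (g • x) • T g v)
    (hmul : ∀ g h v, T g (T h v) = t g h • T (g * h) v)
    (hone : ∀ v, T 1 v = v) : IsCobdry fun g h => t g h ^ Module.finrank L V := by
  classical
  let b := Module.finBasis L V
  let D : G → Matrix (Fin (Module.finrank L V)) (Fin (Module.finrank L V)) L :=
    fun g => Matrix.of fun i j => b.repr (T g (b j)) i
  have hTb : ∀ g j, T g (b j) = ∑ i, D g i j • b i := fun g j => (b.sum_repr (T g (b j))).symm
  have hD : ∀ g h, D g * (D h).map (MulSemiringAction.toRingHom G L g) = t g h • D (g * h) := by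
    intro g h
    ext l j
    have h1 := hmul g h (b j)
    rw [hTb h, map_sum] at h1
    simp_rw [hT, hTb g, Finset.smul_sum, smul_smul] at h1
    rw [Finset.sum_comm] at h1
    simp_rw [← Finset.sum_smul] at h1
    have h2 := congrArg (fun v => b.repr v l) h1
    simp only [b.repr_sum_self, map_smul, Finsupp.smul_apply] at h2
    rw [Matrix.mul_apply, Matrix.smul_apply]
    refine Eq.trans ?_ h2
    refine Finset.sum_congr rfl fun i _ => ?_
    rw [mul_comm]; rfl
  have hdet : ∀ g h, (D g).det * g • (D h).det =
      t g h ^ Module.finrank L V * (D (g * h)).det := by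
    intro g h
    have := congrArg Matrix.det (hD g h)
    rw [Matrix.det_mul, Matrix.det_smul, Fintype.card_fin, ← RingHom.mapMatrix_apply,
      ← RingHom.map_det] at this
    exact this
  have hD1 : D 1 = 1 := by
    ext i j
    simp [D, hone, Matrix.one_apply, Finsupp.single_apply, eq_comm]
  refine ⟨fun g => (D g).det, fun g h0 => ?_, hdet⟩
  -- The relation for $g,g^{-1}$ and $D_1=1$ force $\det D_g\ne0$.
  have := hdet g g⁻¹
  rw [show (D g).det = 0 from h0, zero_mul, mul_inv_cancel, hD1, Matrix.det_one, mul_one] at this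
  exact pow_ne_zero _ (ht _ _) this.symm

omit [Finite G] in
lemma isCobdry_pow_finrank_submodule [FiniteDimensional L V] {t : G → G → L}
    (ht : ∀ g h, t g h ≠ 0)
    (T : G → V →+ V) (hT : ∀ g (x : L) v, T g (x • v) = (g • x) • T g v)
    (hmul : ∀ g h v, T g (T h v) = t g h • T (g * h) v)
    (hone : ∀ v, T 1 v = v) (W : Submodule L V) (hW : ∀ g, ∀ v ∈ W, T g v ∈ W) :
    IsCobdry fun g h => t g h ^ Module.finrank L W :=
  isCobdry_pow_finrank ht
    (fun g =>
      { toFun := fun v => ⟨T g v, hW g v v.2⟩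
        map_zero' := Subtype.ext (map_zero (T g))
        map_add' := fun v w => Subtype.ext (map_add (T g) (v : V) w) })
    (fun g x v => Subtype.ext (hT g x v)) (fun g h v => Subtype.ext (hmul g h v))
    (fun v => Subtype.ext (hone v))

end Descent

/-- A `k`-subspace spanning an `L`-space has at least the dimension of that space. -/
lemma finrank_le_of_span_eq_top {k : Type u} {L : Type v} {M V : Type*} [Field k] [Field L]
    [Algebra k L]
    [AddCommGroup M] [Module k M] [Module L M] [IsScalarTower k L M] [AddCommGroup V] [Module k V]
    [FiniteDimensional k V] (f : V →ₗ[k] M) (hf : Submodule.span L (Set.range f) = ⊤) :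
    Module.finrank L M ≤ Module.finrank k V := by
  let b := Module.finBasis k V
  have hs : Submodule.span L (Set.range (f ∘ b)) = ⊤ := by
    rw [eq_top_iff, ← hf, Submodule.span_le]
    rintro _ ⟨x, rfl⟩
    rw [← b.sum_repr x, map_sum]
    refine Submodule.sum_mem _ fun i _ => ?_
    rw [map_smul, ← algebraMap_smul L]
    exact Submodule.smul_mem _ _ (Submodule.subset_span ⟨i, rfl⟩)
  have := finrank_range_le_card (R := L) (f ∘ b)
  rw [Set.finrank, hs, finrank_top, Fintype.card_fin] at this
  exact this

/-- A linear map from a `k`-space to an `L`-space whose image spans is injective if the dimension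
of the source is not larger. -/
lemma injective_of_span_eq_top {k : Type u} {L : Type v} {M V : Type*} [Field k] [Field L]
    [Algebra k L]
    [AddCommGroup M] [Module k M] [Module L M] [IsScalarTower k L M] [AddCommGroup V] [Module k V]
    [FiniteDimensional k V] (f : V →ₗ[k] M) (hf : Submodule.span L (Set.range f) = ⊤)
    (hle : Module.finrank k V ≤ Module.finrank L M) : Function.Injective f := by
  have h1 : Module.finrank L M ≤ Module.finrank k (LinearMap.range f) := by
    apply finrank_le_of_span_eq_top (LinearMap.range f).subtype
    have : Set.range (LinearMap.range f).subtype = Set.range f := by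
      rw [Submodule.coe_subtype, Subtype.range_coe]; rfl
    rw [this, hf]
  have h2 := LinearMap.finrank_range_add_finrank_ker f
  rw [← LinearMap.ker_eq_bot, ← Submodule.finrank_eq_zero (R := k)]
  omega

/-! ### Twisted permutation modules -/

section Twist

variable {G : Type u} [Group G] {L : Type v} [Field L] [MulSemiringAction G L]
  {X : Type w} [MulAction G X]

/-- The semilinear operators on `X → L` that permute the coordinates and scale them by `φ`. -/
def twist (φ : G → X → L) (h : G) : (X → L) →+ (X → L) where
  toFun v x := φ h (h⁻¹ • x) * h • v (h⁻¹ • x)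
  map_zero' := by funext x; simp
  map_add' v w := by funext x; simp [mul_add]

variable (φ : G → X → L)

lemma twist_smul (h : G) (x : L) (v : X → L) :
    twist φ h (x • v) = (h • x) • twist φ h v := by
  funext y
  simp only [twist, AddMonoidHom.coe_mk, ZeroHom.coe_mk, Pi.smul_apply, smul_eq_mul, smul_mul']
  ring

lemma twist_mul {φ : G → X → L} {τ : G → G → L}
    (hφ : ∀ h k x, φ h (k • x) * h • φ k x = τ h k * φ (h * k) x) (h k : G) (v : X → L) :
    twist φ h (twist φ k v) = τ h k • twist φ (h * k) v := by
  funext y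
  have := hφ h k ((h * k)⁻¹ • y)
  simp only [twist, AddMonoidHom.coe_mk, ZeroHom.coe_mk, Pi.smul_apply, smul_eq_mul, smul_mul',
    smul_smul, ← mul_assoc]
  rw [← this]
  simp [smul_smul, mul_assoc]

lemma twist_one {φ : G → X → L} (hφ : ∀ x, φ 1 x = 1) (v : X → L) : twist φ 1 v = v := by
  funext y
  simp [twist, hφ]

/-- The hypothesis is the entrywise form of commutation, which makes kernel and image of $M$ stable
under the operators. -/
lemma mulVec_twist {φ : G → X → L} [Fintype X] {M : Matrix X X L}
    (hM : ∀ h x y, M (h • x) (h • y) * φ h y = φ h x * h • M x y) (h : G) (v : X → L) :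
    M.mulVec (twist φ h v) = twist φ h (M.mulVec v) := by
  funext y
  simp only [twist, AddMonoidHom.coe_mk, ZeroHom.coe_mk, Matrix.mulVec, dotProduct]
  rw [Finset.smul_sum, Finset.mul_sum]
  refine Fintype.sum_equiv (MulAction.toPerm h⁻¹) _ _ fun x => ?_
  have := hM h (h⁻¹ • y) (h⁻¹ • x)
  rw [smul_inv_smul, smul_inv_smul] at this
  rw [MulAction.toPerm_apply, smul_mul', ← mul_assoc, ← mul_assoc, this]

end Twist

/-! ### Twisted forms of matrix algebras -/

section TwistedForm

variable {G : Type u} [Group G] {L : Type v} [Field L] [MulSemiringAction G L]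

/-- A normalized `2`-cocycle of `G` in the multiplicative group of `L`. -/
structure IsCocycle (t : G → G → L) : Prop where
  ne_zero : ∀ h k, t h k ≠ 0
  one_left : ∀ k, t 1 k = 1
  assoc : ∀ h k g, t h (k * g) * h • t k g = t h k * t (h * k) g

/-- The homomorphism `f` from `A` to matrices over `L` makes `A` a form of the full matrix algebra:
its values commute with the semilinear operators given by `t`, and they span. -/
structure IsTwistedForm [Fintype G] [DecidableEq G] (t : G → G → L) {A : Type w} [Ring A]
    [Algebra (FixedPoints.subfield G L) A]
    (f : A →ₐ[FixedPoints.subfield G L] Matrix G G L) : Prop where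
  comm : ∀ a h k g, f a (h * k) (h * g) * t h g = t h k * h • f a k g
  span : Submodule.span L (Set.range f) = ⊤
  finite : FiniteDimensional (FixedPoints.subfield G L) A
  finrank_le : Module.finrank (FixedPoints.subfield G L) A ≤ Nat.card G ^ 2

variable [Fintype G] [DecidableEq G] {t : G → G → L} {A : Type w} [Ring A]
  [Algebra (FixedPoints.subfield G L) A] {f : A →ₐ[FixedPoints.subfield G L] Matrix G G L}

omit [Group G] [MulSemiringAction G L] [DecidableEq G] in
lemma finrank_matrix_group : Module.finrank L (Matrix G G L) = Nat.card G ^ 2 := by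
  rw [Module.finrank_matrix, Module.finrank_self, Nat.card_eq_fintype_card]; ring

lemma IsTwistedForm.injective (hf : IsTwistedForm t f) : Function.Injective f := by
  have := hf.finite
  exact injective_of_span_eq_top (L := L) f.toLinearMap hf.span
    (hf.finrank_le.trans_eq finrank_matrix_group.symm)

lemma IsTwistedForm.finrank_eq (hf : IsTwistedForm t f) :
    Module.finrank (FixedPoints.subfield G L) A = Nat.card G ^ 2 := by
  have := hf.finite
  refine le_antisymm hf.finrank_le ?_
  rw [← finrank_matrix_group (L := L)]
  exact finrank_le_of_span_eq_top (L := L) f.toLinearMap hf.span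

/-- The image of a central element commutes with the $L$-span of the image of $A$, that is, with all
matrices. So it is a scalar, and compatibility with $t$ makes this scalar $G$-invariant. -/
lemma IsTwistedForm.isCentral (ht : IsCocycle t) (hf : IsTwistedForm t f) :
    Algebra.IsCentral (FixedPoints.subfield G L) A := by
  refine ⟨fun a ha => ?_⟩
  have h1 : f a ∈ Subalgebra.center L (Matrix G G L) := by
    rw [Subalgebra.mem_center_iff]
    intro M
    have hM : M ∈ Submodule.span L (Set.range f) := by rw [hf.span]; trivial
    induction hM using Submodule.span_induction with
    | mem x hx =>
      obtain ⟨b, rfl⟩ := hx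
      rw [← map_mul, ← map_mul, (Subalgebra.mem_center_iff.1 ha) b]
    | zero => simp
    | add x y _ _ hx hy => rw [add_mul, mul_add, hx, hy]
    | smul c x _ hx => rw [Matrix.smul_mul, Matrix.mul_smul, hx]
  rw [Matrix.subalgebraCenter_eq_scalarAlgHom_map] at h1
  obtain ⟨c, -, hc⟩ := h1
  have hc' : Matrix.scalar G c = f a := hc
  have hfix : ∀ h : G, h • c = c := by
    intro h
    have h2 := hf.comm a h 1 1
    rw [← hc'] at h2
    simp only [Matrix.scalar_apply, Matrix.diagonal_apply_eq] at h2
    rw [mul_comm] at h2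
    exact (mul_left_cancel₀ (ht.ne_zero h 1) h2).symm
  rw [Algebra.mem_bot]
  refine ⟨⟨c, hfix⟩, hf.injective ?_⟩
  rw [AlgHom.commutes, ← hc']
  rfl

/-- If only the powers of `t` with exponent divisible by `|G|` are coboundaries, then a twisted form
has no zero divisors. -/
lemma IsTwistedForm.isDomain (ht : IsCocycle t) (hf : IsTwistedForm t f)
    (hdvd : ∀ w : ℕ, IsCobdry (fun g h => t g h ^ w) → Nat.card G ∣ w) : IsDomain A := by
  have : Nontrivial A := by
    by_contra h
    rw [not_nontrivial_iff_subsingleton] at h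
    have h1 := hf.finrank_eq
    rw [Module.finrank_zero_of_subsingleton] at h1
    exact pow_ne_zero 2 Nat.card_pos.ne' h1.symm
  -- The kernel is stable under the twisted operators, so $|G|$ divides its dimension, which is at
  -- most $|G|$. A full kernel would give $a=0$.
  have key : ∀ a : A, a ≠ 0 → LinearMap.ker (Matrix.toLin' (f a)) = ⊥ := by
    intro a ha
    have hstab := isCobdry_pow_finrank_submodule ht.ne_zero (twist t) (twist_smul t)
      (twist_mul (fun h k g => ht.assoc h k g)) (twist_one ht.one_left)
      (LinearMap.ker (Matrix.toLin' (f a))) (by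
        intro g v hv
        rw [LinearMap.mem_ker, Matrix.toLin'_apply] at hv ⊢
        rw [mulVec_twist (fun h x y => hf.comm a h x y), hv, map_zero])
    rw [← Submodule.finrank_eq_zero (R := L)]
    by_contra h0
    have h1 := Nat.le_of_dvd (Nat.pos_of_ne_zero h0) (hdvd _ hstab)
    have h2 : Module.finrank L (G → L) = Nat.card G := by simp
    have h3 := Submodule.eq_top_of_finrank_eq
      (le_antisymm (Submodule.finrank_le (LinearMap.ker (Matrix.toLin' (f a)))) (h2 ▸ h1))
    rw [LinearMap.ker_eq_top] at h3
    apply ha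
    apply hf.injective
    rw [map_zero]
    exact Matrix.toLin'.injective (by rw [h3, map_zero])
  have : NoZeroDivisors A := by
    refine ⟨fun {a b} hab => ?_⟩
    by_contra hne
    push Not at hne
    apply hne.2
    apply hf.injective
    have h0 : f a * f b = 0 := by rw [← map_mul, hab, map_zero]
    rw [map_zero]
    apply Matrix.toLin'.injective
    rw [map_zero]
    ext1 i
    have hk := LinearMap.ker_eq_bot.1 (key a hne.1)
    ext1
    rw [LinearMap.comp_apply]
    apply hk
    rw [← LinearMap.comp_apply (Matrix.toLin' (f a)), ← Matrix.toLin'_mul, h0]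
    simp
  exact NoZeroDivisors.to_isDomain A

end TwistedForm

/-! ### Tensor powers of twisted forms -/

section TensorPower

variable {G : Type u} [Group G] {L : Type v} [Field L] [MulSemiringAction G L]
  [Fintype G] [DecidableEq G] {t : G → G → L} {A : Type w} [Ring A]
  [Algebra (FixedPoints.subfield G L) A]

/-- The Kronecker product of matrices, as a homomorphism from the tensor power. -/
def kron (f : A →ₐ[FixedPoints.subfield G L] Matrix G G L) (m : ℕ) :
    (⨂[FixedPoints.subfield G L] _ : Fin m, A) →ₐ[FixedPoints.subfield G L]
      Matrix (Fin m → G) (Fin m → G) L :=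
  PiTensorProduct.liftAlgHom
    { toFun := fun a => Matrix.of fun x y => ∏ i, f (a i) (x i) (y i)
      map_update_add' := fun a i b c => by
        ext x y
        rw [Matrix.add_apply]
        simp only [Matrix.of_apply]
        rw [← Finset.mul_prod_erase _ _ (Finset.mem_univ i),
          ← Finset.mul_prod_erase _ (fun j => f (Function.update a i b j) (x j) (y j))
            (Finset.mem_univ i),
          ← Finset.mul_prod_erase _ (fun j => f (Function.update a i c j) (x j) (y j))
            (Finset.mem_univ i)]
        have h : ∀ d : A, ∏ j ∈ Finset.univ.erase i, f (Function.update a i d j) (x j) (y j)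
            = ∏ j ∈ Finset.univ.erase i, f (a j) (x j) (y j) := fun d =>
          Finset.prod_congr rfl fun j hj => by
            rw [Function.update_of_ne (Finset.ne_of_mem_erase hj)]
        simp only [h, Function.update_self, map_add, Matrix.add_apply, add_mul]
      map_update_smul' := fun a i c b => by
        ext x y
        rw [Matrix.smul_apply]
        simp only [Matrix.of_apply]
        rw [← Finset.mul_prod_erase _ _ (Finset.mem_univ i),
          ← Finset.mul_prod_erase _ (fun j => f (Function.update a i b j) (x j) (y j))
            (Finset.mem_univ i)]
        have h : ∀ d : A, ∏ j ∈ Finset.univ.erase i, f (Function.update a i d j) (x j) (y j)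
            = ∏ j ∈ Finset.univ.erase i, f (a j) (x j) (y j) := fun d =>
          Finset.prod_congr rfl fun j hj => by
            rw [Function.update_of_ne (Finset.ne_of_mem_erase hj)]
        simp only [h, Function.update_self, map_smul, Matrix.smul_apply, smul_mul_assoc] }
    (by
      ext x y
      simp only [MultilinearMap.coe_mk, Matrix.of_apply, Pi.one_apply, map_one, Matrix.one_apply]
      rw [Fintype.prod_ite_zero]
      simp [funext_iff])
    (fun a b => by
      ext x y
      simp only [MultilinearMap.coe_mk, Matrix.of_apply, Pi.mul_apply, map_mul, Matrix.mul_apply]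
      rw [Finset.prod_univ_sum, Fintype.piFinset_univ]
      simp_rw [Finset.prod_mul_distrib])

variable {f : A →ₐ[FixedPoints.subfield G L] Matrix G G L} {m : ℕ}

lemma kron_tprod (a : Fin m → A) (x y : Fin m → G) :
    kron f m (PiTensorProduct.tprod _ a) x y = ∏ i, f (a i) (x i) (y i) := by
  simp [kron]

lemma kron_comm (hf : IsTwistedForm t f) (a : ⨂[FixedPoints.subfield G L] _ : Fin m, A) (h : G)
    (x y : Fin m → G) : kron f m a (h • x) (h • y) * ∏ i, t h (y i)
      = (∏ i, t h (x i)) * h • kron f m a x y := by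
  induction a using PiTensorProduct.induction_on with
  | smul_tprod c a =>
    have hc : ∀ z : L, h • (c • z) = c • h • z := fun z => smul_comm h c z
    simp only [map_smul, Matrix.smul_apply, kron_tprod, hc]
    rw [smul_mul_assoc, mul_smul_comm, ← Finset.prod_mul_distrib,
      Finset.smul_prod', ← Finset.prod_mul_distrib]
    congr 1
    exact Finset.prod_congr rfl fun i _ => hf.comm (a i) h (x i) (y i)
  | add a b ha hb => rw [map_add, Matrix.add_apply, Matrix.add_apply, add_mul, ha, hb, smul_add,
      mul_add]

/-- A matrix unit over $G^m$ is a Kronecker product of matrix units over $G$. Expand each factor in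
the spanning set $f(b_j)$ and distribute the product. -/
lemma span_range_kron (hf : IsTwistedForm t f) :
    Submodule.span L (Set.range (kron f m)) = ⊤ := by
  have := hf.finite
  let b := Module.finBasis (FixedPoints.subfield G L) A
  have hs : Submodule.span L (Set.range (f ∘ b)) = ⊤ := by
    rw [eq_top_iff, ← hf.span, Submodule.span_le]
    rintro _ ⟨x, rfl⟩
    rw [← b.sum_repr x, map_sum]
    refine Submodule.sum_mem _ fun i _ => ?_
    rw [map_smul, ← algebraMap_smul L]
    exact Submodule.smul_mem _ _ (Submodule.subset_span ⟨i, rfl⟩)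
  have hsingle : ∀ x y : G, ∃ c : _ → L, ∑ j, c j • f (b j) = Matrix.single x y 1 := fun x y =>
    (Submodule.mem_span_range_iff_exists_fun L).1 (by
      rw [show (Set.range fun j => f (b j)) = Set.range (f ∘ b) from rfl, hs]; trivial)
  choose c hc using hsingle
  rw [eq_top_iff]
  intro M _
  rw [Matrix.matrix_eq_sum_single M]
  refine Submodule.sum_mem _ fun x _ => Submodule.sum_mem _ fun y _ => ?_
  have hxy : Matrix.single x y (M x y) = M x y • ∑ J : Fin m → _,
      (∏ i, c (x i) (y i) (J i)) • kron f m (PiTensorProduct.tprod _ fun i => b (J i)) := by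
    ext u v
    simp only [Matrix.smul_apply, Matrix.sum_apply, kron_tprod, smul_eq_mul,
      ← Finset.prod_mul_distrib]
    have hi : ∀ i, (∑ j, c (x i) (y i) j * f (b j) (u i) (v i))
        = if x i = u i ∧ y i = v i then 1 else 0 := by
      intro i
      have h2 := congrFun (congrFun (hc (x i) (y i)) (u i)) (v i)
      rw [Matrix.sum_apply] at h2
      simpa [Matrix.single_apply] using h2
    have h3 := Finset.prod_univ_sum (fun _ : Fin m => Finset.univ)
      (fun i j => c (x i) (y i) j * f (b j) (u i) (v i))
    rw [Fintype.piFinset_univ] at h3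
    rw [← h3]
    simp_rw [hi]
    rw [Fintype.prod_ite_zero, Matrix.single_apply]
    simp [funext_iff, forall_and]
  rw [hxy]
  exact Submodule.smul_mem _ _ (Submodule.sum_mem _ fun J _ =>
    Submodule.smul_mem _ _ (Submodule.subset_span ⟨_, rfl⟩))

lemma finrank_tensorPower (k : Type u) (A : Type v) [Field k] [Ring A] [Algebra k A]
    [FiniteDimensional k A] (m : ℕ) :
    Module.finrank k (⨂[k] _ : Fin m, A) = Module.finrank k A ^ m := by
  rw [Module.finrank_eq_card_basis
    (Basis.piTensorProduct fun _ : Fin m => Module.finBasis k A)]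
  simp

instance finite_tensorPower (k : Type u) (A : Type v) [Field k] [Ring A] [Algebra k A]
    [FiniteDimensional k A] (m : ℕ) : FiniteDimensional k (⨂[k] _ : Fin m, A) :=
  (Basis.piTensorProduct fun _ : Fin m => Module.finBasis k A).finiteDimensional_of_finite

lemma IsTwistedForm.finrank_tensorPower_eq (hf : IsTwistedForm t f) :
    Module.finrank (FixedPoints.subfield G L) (⨂[FixedPoints.subfield G L] _ : Fin m, A)
      = Nat.card (Fin m → G) * Nat.card (Fin m → G) := by
  have := hf.finite
  rw [finrank_tensorPower, hf.finrank_eq, Nat.card_fun]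
  simp only [Nat.card_eq_fintype_card, Fintype.card_fin]
  ring

lemma kron_injective (hf : IsTwistedForm t f) : Function.Injective (kron f m) := by
  have := hf.finite
  refine injective_of_span_eq_top (L := L) (kron f m).toLinearMap (span_range_kron hf) ?_
  rw [hf.finrank_tensorPower_eq, Module.finrank_matrix, Module.finrank_self,
    Nat.card_eq_fintype_card, mul_one]

omit [Fintype G] [DecidableEq G] in
-- Each of the $m$ coordinates contributes one factor $t(h,k)$, so the operators on $L^{G^m}$ have
-- cocycle $t^m$.
lemma prod_cocycle (ht : IsCocycle t) (h k : G) (x : Fin m → G) :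
    (∏ i, t h ((k • x) i)) * h • ∏ i, t k (x i) = t h k ^ m * ∏ i, t (h * k) (x i) := by
  rw [Finset.smul_prod', ← Finset.prod_mul_distrib]
  simp_rw [Pi.smul_apply, smul_eq_mul, ht.assoc, Finset.prod_mul_distrib]
  simp

/-- If the `m`-th power of the cocycle is a coboundary, then the `m`-th tensor power of a twisted
form is split. -/
lemma IsTwistedForm.isSplit_of_isCobdry [FaithfulSMul G L] (ht : IsCocycle t)
    (hf : IsTwistedForm t f) (hm : IsCobdry fun g h => t g h ^ m) :
    IsSplit (FixedPoints.subfield G L) (⨂[FixedPoints.subfield G L] _ : Fin m, A) := by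
  have := hf.finite
  obtain ⟨a, ha0, ha⟩ := hm
  have ha1 : a 1 = 1 := by
    have := ha 1 1
    simp only [one_smul, ht.one_left, one_pow, mul_one, one_mul] at this
    exact mul_left_cancel₀ (ha0 1) (this.trans (mul_one _).symm)
  -- Dividing by $a$ cancels the cocycle $t^m$: the twisted operators become a genuine semilinear
  -- action.
  let φ : G → (Fin m → G) → L := fun h x => (∏ i, t h (x i)) * (a h)⁻¹
  have hφ : ∀ h k x, φ h (k • x) * h • φ k x = 1 * φ (h * k) x := by
    intro h k x
    have h1 := prod_cocycle ht h k x
    have h2 := ha h k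
    have h3 : h • a k ≠ 0 := (smul_ne_zero_iff_ne h).2 (ha0 k)
    simp only [φ, smul_mul', smul_inv'']
    calc _ = ((∏ i, t h ((k • x) i)) * h • ∏ i, t k (x i)) * (a h * h • a k)⁻¹ := by
          rw [mul_inv]; ring
      _ = _ := by
          rw [h1, h2]
          have := pow_ne_zero m (ht.ne_zero h k)
          field_simp
  have hφ1 : ∀ x, φ 1 x = 1 := fun x => by simp [φ, ha1, ht.one_left]
  have hcomm : ∀ z h v, (kron f m z).mulVec (twist φ h v) = twist φ h ((kron f m z).mulVec v) := by
    intro z h v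
    refine mulVec_twist (fun h x y => ?_) h v
    have := kron_comm hf z h x y
    simp only [φ]
    rw [← mul_assoc, this]
    ring
  have hspan := span_fixed (twist φ) (twist_smul φ)
    (fun h k v => by rw [twist_mul hφ, one_smul]) (twist_one hφ1)
  -- By descent there is a basis of invariant vectors. In it, matrices commuting with the action
  -- have entries in the fixed field.
  let b0 := Module.Basis.ofSpan hspan.ge
  have hb0 : ∀ i h, twist φ h (b0 i) = b0 i := by
    intro i
    have : b0 i ∈ {v : (Fin m → G) → L | ∀ g, twist φ g v = v} :=
      Module.Basis.ofSpan_subset hspan.ge ⟨i, rfl⟩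
    exact this
  let b := b0.reindex (b0.indexEquiv (Pi.basisFun L (Fin m → G)))
  have hb : ∀ i h, twist φ h (b i) = b i := by
    intro i h
    simp only [b, Module.Basis.reindex_apply, hb0]
  let Θ : (⨂[FixedPoints.subfield G L] _ : Fin m, A) →ₐ[FixedPoints.subfield G L]
      Matrix (Fin m → G) (Fin m → G) L :=
    (((LinearMap.toMatrixAlgEquiv b).toAlgHom.comp Matrix.toLinAlgEquiv'.toAlgHom).restrictScalars
      (FixedPoints.subfield G L)).comp (kron f m)
  have hΘ : ∀ z x y, Θ z x y = b.repr ((kron f m z).mulVec (b y)) x := by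
    intro z x y
    simp [Θ, LinearMap.toMatrixAlgEquiv_apply]
  have hΘinj : Function.Injective Θ := by
    have h1 := (LinearMap.toMatrixAlgEquiv b).injective.comp
      ((Matrix.toLinAlgEquiv' (R := L) (n := Fin m → G)).injective.comp (kron_injective hf))
    exact h1
  have hfix : ∀ z x y (h : G), h • Θ z x y = Θ z x y := by
    intro z x y h
    have h1 : twist φ h ((kron f m z).mulVec (b y)) = (kron f m z).mulVec (b y) := by
      rw [← hcomm, hb]
    have h2 := congrArg (fun v => b.repr (twist φ h v) x) (b.sum_repr ((kron f m z).mulVec (b y)))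
    simp only [h1, map_sum, twist_smul, hb] at h2
    rw [← map_sum, b.repr_sum_self] at h2
    rw [hΘ, h2]
  let ι : Matrix (Fin m → G) (Fin m → G) (FixedPoints.subfield G L) →ₐ[FixedPoints.subfield G L]
      Matrix (Fin m → G) (Fin m → G) L :=
    (Algebra.ofId (FixedPoints.subfield G L) L).mapMatrix
  have hι : Function.Injective ι := by
    intro M N hMN
    ext x y
    exact congrFun (congrFun hMN x) y
  have hmem : ∀ z, Θ z ∈ ι.range := fun z =>
    ⟨Matrix.of fun x y => ⟨Θ z x y, hfix z x y⟩, rfl⟩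
  let Ψ := (AlgEquiv.ofInjective ι hι).symm.toAlgHom.comp (Θ.codRestrict ι.range hmem)
  have hΨ : Function.Injective Ψ := by
    apply (AlgEquiv.ofInjective ι hι).symm.injective.comp
    exact fun z w hzw => hΘinj (congrArg Subtype.val hzw)
  have hdim : Module.finrank (FixedPoints.subfield G L)
      (⨂[FixedPoints.subfield G L] _ : Fin m, A) = Module.finrank (FixedPoints.subfield G L)
      (Matrix (Fin m → G) (Fin m → G) (FixedPoints.subfield G L)) := by
    rw [hf.finrank_tensorPower_eq, Module.finrank_matrix, Module.finrank_self,
      Nat.card_eq_fintype_card, mul_one]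
  have hbij : Function.Bijective Ψ :=
    ⟨hΨ, (LinearMap.injective_iff_surjective_of_finrank_eq_finrank (f := Ψ.toLinearMap) hdim).1 hΨ⟩
  refine ⟨Fintype.card (Fin m → G), Fintype.card_ne_zero, ⟨?_⟩⟩
  exact (AlgEquiv.ofBijective Ψ hbij).trans
    (Matrix.reindexAlgEquiv _ _ (Fintype.equivFin (Fin m → G)))

/-- If the `m`-th tensor power of a twisted form is split, then the `m`-th power of the cocycle is a
coboundary. -/
lemma IsTwistedForm.isCobdry_of_isSplit (ht : IsCocycle t) (hf : IsTwistedForm t f)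
    (hm : IsSplit (FixedPoints.subfield G L) (⨂[FixedPoints.subfield G L] _ : Fin m, A)) :
    IsCobdry fun g h => t g h ^ m := by
  obtain ⟨k, hk0, ⟨E⟩⟩ := hm
  have hk : k = Nat.card (Fin m → G) := by
    have h1 := E.toLinearEquiv.finrank_eq
    rw [hf.finrank_tensorPower_eq, Module.finrank_matrix, Module.finrank_self, mul_one,
      Fintype.card_fin] at h1
    exact (Nat.mul_self_inj.1 h1).symm
  let ρ := (kron f m).comp E.symm.toAlgHom
  let z : Fin k := ⟨0, Nat.pos_of_ne_zero hk0⟩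
  let ε : Fin k → Fin k → Matrix (Fin k) (Fin k) (FixedPoints.subfield G L) :=
    fun i j => Matrix.single i j 1
  -- The image of a rank-one idempotent of the split algebra. The matrix units identify the whole
  -- space with $k$ copies of it, and since $k=|G|^m$ it is a line.
  let W : Submodule L ((Fin m → G) → L) := LinearMap.range (Matrix.toLin' (ρ (ε z z)))
  have hstab : ∀ g, ∀ v ∈ W, twist (fun h (x : Fin m → G) => ∏ i, t h (x i)) g v ∈ W := by
    rintro g _ ⟨v, rfl⟩
    refine ⟨twist (fun h (x : Fin m → G) => ∏ i, t h (x i)) g v, ?_⟩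
    rw [Matrix.toLin'_apply, Matrix.toLin'_apply]
    exact mulVec_twist (fun h x y => kron_comm hf _ h x y) g v
  have hmulε : ∀ i j l, ρ (ε i j) * ρ (ε j l) = ρ (ε i l) := by
    intro i j l
    rw [← map_mul]
    simp [ε]
  have hmulε' : ∀ i j j' l, j ≠ j' → ρ (ε i j) * ρ (ε j' l) = 0 := by
    intro i j j' l hne
    rw [← map_mul]
    simp [ε, hne]
  have hsum : ∑ i, ρ (ε i i) = 1 := by
    rw [← map_sum]
    have : ∑ i, ε i i = 1 := by
      ext a b
      simp [ε, Matrix.sum_apply, Matrix.single_apply, Matrix.one_apply, ite_and]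
    rw [this, map_one]
  have hW : ∀ w ∈ W, (ρ (ε z z)).mulVec w = w := by
    rintro _ ⟨v, rfl⟩
    rw [Matrix.toLin'_apply, Matrix.mulVec_mulVec, hmulε]
  let Φ : ((Fin m → G) → L) ≃ₗ[L] (Fin k → W) :=
    { toFun := fun v i => ⟨(ρ (ε z i)).mulVec v, (ρ (ε z i)).mulVec v, by
        rw [Matrix.toLin'_apply, Matrix.mulVec_mulVec, hmulε]⟩
      map_add' := fun v w => by
        funext i
        exact Subtype.ext (Matrix.mulVec_add _ _ _)
      map_smul' := fun c v => by
        funext i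
        exact Subtype.ext (Matrix.mulVec_smul _ _ _)
      invFun := fun w => ∑ i, (ρ (ε i z)).mulVec (w i)
      left_inv := fun v => by
        simp only [Matrix.mulVec_mulVec, hmulε]
        rw [← Matrix.sum_mulVec, hsum, Matrix.one_mulVec]
      right_inv := fun w => by
        funext i
        apply Subtype.ext
        simp only [Matrix.mulVec_sum, Matrix.mulVec_mulVec]
        rw [Finset.sum_eq_single i]
        · rw [hmulε, hW _ (w i).2]
        · intro j _ hj
          rw [hmulε' _ _ _ _ hj.symm, Matrix.zero_mulVec]
        · simp }
  have hrank : Module.finrank L W = 1 := by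
    have h1 := Φ.finrank_eq
    rw [Module.finrank_pi, Module.finrank_pi_fintype, Finset.sum_const, Finset.card_univ,
      Fintype.card_fin, smul_eq_mul, ← Nat.card_eq_fintype_card, ← hk] at h1
    exact (Nat.eq_of_mul_eq_mul_left (Nat.pos_of_ne_zero hk0) (by rw [← h1, mul_one]))
  have := isCobdry_pow_finrank_submodule (t := fun g h => t g h ^ m)
    (fun g h => pow_ne_zero m (ht.ne_zero g h)) _ (twist_smul _)
    (twist_mul (prod_cocycle ht)) (twist_one fun x => by simp [ht.one_left]) W hstab
  simpa only [hrank, pow_one] using this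

end TensorPower

/-! ### Group rings of free abelian groups -/

section GroupRing

/-- $F[A]$ is the localization of $F[M]$ at the monomials, because every element of $A$ is a
difference of elements from $M$; factoriality passes to localizations. -/
lemma uniqueFactorizationMonoid_of_mapDomain {F M A : Type*} [Field F] [AddCommMonoid M]
    [AddCommGroup A] (f : M →+ A) (hf : Function.Injective f)
    (hsurj : ∀ a, ∃ m m', f m' = f m + a)
    [UniqueFactorizationMonoid (AddMonoidAlgebra F M)] :
    UniqueFactorizationMonoid (AddMonoidAlgebra F A) := by
  let φ : AddMonoidAlgebra F M →+* AddMonoidAlgebra F A := AddMonoidAlgebra.mapDomainRingHom F f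
  have hφ : ∀ m c, φ (AddMonoidAlgebra.single m c) = AddMonoidAlgebra.single (f m) c := fun m c =>
    AddMonoidAlgebra.mapDomain_single
  let _ := φ.toAlgebra
  let S : Submonoid (AddMonoidAlgebra F M) :=
    MonoidHom.mrange (AddMonoidAlgebra.of F M)
  have : IsLocalization S (AddMonoidAlgebra F A) := by
    refine ⟨?_, ?_, ?_⟩
    · rintro ⟨_, m, rfl⟩
      change IsUnit (φ (AddMonoidAlgebra.single m.toAdd 1))
      rw [hφ]
      refine IsUnit.of_mul_eq_one (AddMonoidAlgebra.single (-f m.toAdd) 1) ?_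
      rw [AddMonoidAlgebra.single_mul_single, add_neg_cancel, mul_one, AddMonoidAlgebra.one_def]
    · intro x
      suffices h : ∃ (m : M) (y : AddMonoidAlgebra F M),
          AddMonoidAlgebra.single (f m) 1 * x = φ y by
        obtain ⟨m, y, h⟩ := h
        refine ⟨(y, ⟨AddMonoidAlgebra.single m 1, Multiplicative.ofAdd m, rfl⟩), ?_⟩
        change x * φ (AddMonoidAlgebra.single m 1) = φ y
        rw [hφ, mul_comm, h]
      induction x using AddMonoidAlgebra.induction_linear with
      | zero => exact ⟨0, 0, by simp⟩
      | add x y hx hy =>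
        obtain ⟨m, x', hx⟩ := hx
        obtain ⟨n, y', hy⟩ := hy
        refine ⟨m + n, AddMonoidAlgebra.single n 1 * x' + AddMonoidAlgebra.single m 1 * y', ?_⟩
        rw [map_add f, map_add φ, map_mul, map_mul, ← hx, ← hy, hφ, hφ, mul_add, ← mul_assoc,
          ← mul_assoc, AddMonoidAlgebra.single_mul_single, AddMonoidAlgebra.single_mul_single,
          mul_one, add_comm (f n)]
      | single a c =>
        obtain ⟨m, m', h⟩ := hsurj a
        refine ⟨m, AddMonoidAlgebra.single m' c, ?_⟩
        rw [hφ, h, AddMonoidAlgebra.single_mul_single, one_mul]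
    · intro x y hxy
      have hinj : Function.Injective φ := AddMonoidAlgebra.mapDomain_injective hf
      exact ⟨1, by rw [hinj hxy]⟩
  exact UniqueFactorizationMonoid.of_isLocalization S (AddMonoidAlgebra F A)

instance uniqueFactorizationMonoid_finsupp_nat (F : Type*) [Field F] (n : ℕ) :
    UniqueFactorizationMonoid (AddMonoidAlgebra F (Fin n →₀ ℕ)) :=
  inferInstanceAs (UniqueFactorizationMonoid (MvPolynomial (Fin n) F))

/-- The group ring of a finitely generated free abelian group is factorial. -/
lemma uniqueFactorizationMonoid_addMonoidAlgebra (F A : Type*) [Field F] [AddCommGroup A]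
    [Module.Free ℤ A] [Module.Finite ℤ A] :
    UniqueFactorizationMonoid (AddMonoidAlgebra F A) := by
  let b := Module.finBasis ℤ A
  let c : (Fin (Module.finrank ℤ A) →₀ ℕ) →+ (Fin (Module.finrank ℤ A) →₀ ℤ) :=
    Finsupp.mapRange.addMonoidHom (Nat.castAddMonoidHom ℤ)
  refine uniqueFactorizationMonoid_of_mapDomain
    ((b.repr.symm.toAddEquiv.toAddMonoidHom).comp c) ?_ ?_
  · intro x y hxy
    have h1 : c x = c y := b.repr.symm.injective hxy
    ext i
    have h2 := DFunLike.congr_fun h1 i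
    simpa [c] using h2
  · intro a
    -- Coordinatewise $x=(x+|x|)-|x|$ with both terms nonnegative.
    refine ⟨Finsupp.equivFunOnFinite.symm fun i => (b.repr a i).natAbs,
      Finsupp.equivFunOnFinite.symm fun i => (b.repr a i + (b.repr a i).natAbs).toNat, ?_⟩
    apply b.repr.injective
    ext i
    have : ∀ x, b.repr ((b.repr.symm.toAddEquiv.toAddMonoidHom.comp c) x) = c x := fun x =>
      b.repr.apply_symm_apply _
    rw [map_add, this, this]
    simp only [c, Finsupp.mapRange.addMonoidHom_apply, Finsupp.mapRange_apply, Finsupp.add_apply,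
      Finsupp.equivFunOnFinite_symm_apply_apply, Nat.coe_castAddMonoidHom]
    omega

/-- Group rings of groups with unique sums have only trivial units. -/
lemma exists_single_of_isUnit {F A : Type*} [Field F] [AddCommGroup A] [UniqueSums A]
    {x : AddMonoidAlgebra F A} (hx : IsUnit x) : ∃ a c, c ≠ 0 ∧ x = AddMonoidAlgebra.single a c := by
  have := UniqueSums.toTwoUniqueSums_of_addGroup (G := A)
  obtain ⟨y, hxy⟩ := hx.exists_right_inv
  have hx0 : x ≠ 0 := hx.ne_zero
  have hy0 : y ≠ 0 := by
    rintro rfl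
    rw [mul_zero] at hxy
    exact zero_ne_one hxy
  have hxs : x.coeff.support.Nonempty := by
    rw [Finsupp.support_nonempty_iff, Ne, AddMonoidAlgebra.coeff_eq_zero]; exact hx0
  have hys : y.coeff.support.Nonempty := by
    rw [Finsupp.support_nonempty_iff, Ne, AddMonoidAlgebra.coeff_eq_zero]; exact hy0
  -- Otherwise two different pairs have uniquely represented sums. Both give nonzero coefficients of
  -- $xy=1$, so both sums are $0$, against uniqueness.
  have hcard : x.coeff.support.card * y.coeff.support.card ≤ 1 := by
    by_contra hlt
    obtain ⟨p, hp, q, hq, hpq, hup, huq⟩ :=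
      TwoUniqueSums.uniqueAdd_of_one_lt_card (not_le.1 hlt)
    rw [Finset.mem_product] at hp hq
    have hval : ∀ z : A × A, z.1 ∈ x.coeff.support ∧ z.2 ∈ y.coeff.support →
        UniqueAdd x.coeff.support y.coeff.support z.1 z.2 → z.1 + z.2 = 0 := by
      intro z hz hu
      have h1 := AddMonoidAlgebra.coeff_mul_add_of_uniqueAdd hu
      rw [hxy, AddMonoidAlgebra.one_def, AddMonoidAlgebra.coeff_single] at h1
      by_contra h0
      rw [Finsupp.single_eq_of_ne h0] at h1
      exact mul_ne_zero (Finsupp.mem_support_iff.1 hz.1) (Finsupp.mem_support_iff.1 hz.2) h1.symm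
    have h1 := hval p hp hup
    have h2 := hval q hq huq
    have h3 := hup hq.1 hq.2 (h2.trans h1.symm)
    exact hpq (Prod.ext h3.1.symm h3.2.symm)
  have h1 : x.coeff.support.card = 1 := by
    have := hxs.card_pos
    have := hys.card_pos
    nlinarith
  obtain ⟨a, c, hc, h⟩ := Finsupp.card_support_eq_one'.1 h1
  exact ⟨a, c, hc, AddMonoidAlgebra.coeff_injective h⟩

end GroupRing

/-! ### Elements without `n`-th power factors -/

section PowerFree

variable {R : Type u} [CommRing R] [IsDomain R] [UniqueFactorizationMonoid R] {L : Type v} [Field L]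
  [Algebra R L] [IsFractionRing R L] {n : ℕ}

omit [IsDomain R] in
-- Split off $n$-th powers of nonunits; this stops because proper divisibility is well-founded.
lemma exists_eq_pow_mul_powerFree (hn : 0 < n) (x : R) :
    x ≠ 0 → ∃ y w : R, x = y ^ n * w ∧ ∀ b, b ^ n ∣ w → IsUnit b := by
  induction x using (IsWellFounded.wf (α := R) (r := DvdNotUnit)).induction with
  | _ x ih =>
    intro hx
    by_cases h : ∀ b, b ^ n ∣ x → IsUnit b
    · exact ⟨1, x, by simp, h⟩
    · push Not at h
      obtain ⟨b, ⟨c, hc⟩, hb⟩ := h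
      have hc0 : c ≠ 0 := by
        rintro rfl
        exact hx (by simpa using hc)
      obtain ⟨y, w, hyw, hw⟩ := ih c ⟨hc0, b ^ n, by rwa [isUnit_pow_iff hn.ne'], by
        rw [hc, mul_comm]⟩ hc0
      exact ⟨b * y, w, by rw [hc, hyw, mul_pow, mul_assoc], hw⟩

lemma exists_eq_pow_mul_algebraMap_powerFree (hn : 0 < n) (x : L) (hx : x ≠ 0) :
    ∃ (y : L) (w : R), y ≠ 0 ∧ x = y ^ n * algebraMap R L w ∧
      ∀ b, b ^ n ∣ w → IsUnit b := by
  obtain ⟨p, q, hq, rfl⟩ := IsFractionRing.div_surjective (A := R) x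
  have hq0 : algebraMap R L q ≠ 0 := IsFractionRing.to_map_ne_zero_of_mem_nonZeroDivisors hq
  have hp0 : p ≠ 0 := by
    rintro rfl
    simp at hx
  have hq1 : q ≠ 0 := nonZeroDivisors.ne_zero hq
  -- Since $p/q=pq^{n-1}/q^n$, the denominator may be taken to be an $n$-th power.
  obtain ⟨y, w, hyw, hw⟩ := exists_eq_pow_mul_powerFree hn (p * q ^ (n - 1))
    (mul_ne_zero hp0 (pow_ne_zero _ hq1))
  have hyw0 : y ^ n * w ≠ 0 := hyw ▸ mul_ne_zero hp0 (pow_ne_zero _ hq1)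
  have hy0 : y ≠ 0 := by
    rintro rfl
    simp [hn.ne'] at hyw0
  refine ⟨algebraMap R L y / algebraMap R L q, w, div_ne_zero ?_ hq0, ?_, hw⟩
  · rwa [Ne, FaithfulSMul.algebraMap_eq_zero_iff]
  · have h1 := congrArg (algebraMap R L) hyw
    rw [map_mul, map_mul, map_pow, map_pow] at h1
    rw [div_pow, div_mul_eq_mul_div, ← h1, eq_div_iff (pow_ne_zero _ hq0), div_mul_eq_mul_div,
      div_eq_iff hq0]
    obtain ⟨k, rfl⟩ : ∃ k, n = k + 1 := ⟨n - 1, by omega⟩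
    rw [Nat.add_sub_cancel]
    ring

/-- If elements without `n`-th power factors differ by the `n`-th power of `z` and a unit, then `z`
is a unit. -/
lemma exists_isUnit_of_pow_mul_powerFree {w w' u : R} (hu : IsUnit u)
    (hw : ∀ b, b ^ n ∣ w → IsUnit b) (hw' : ∀ b, b ^ n ∣ w' → IsUnit b) {z : L}
    (h : z ^ n * algebraMap R L w' = algebraMap R L (u * w)) :
    ∃ v : R, IsUnit v ∧ algebraMap R L v = z := by
  have hred := IsFractionRing.num_den_reduced R z
  have hz := IsFractionRing.mk'_num_den' R z
  set a := IsFractionRing.num R z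
  set b : R := (IsFractionRing.den R z : R)
  have hb0 : b ≠ 0 := nonZeroDivisors.coe_ne_zero _
  have hb0' : algebraMap R L b ≠ 0 := by rwa [Ne, FaithfulSMul.algebraMap_eq_zero_iff]
  -- With $z=a/b$ in lowest terms, $b^n$ must divide $w'$ and $a^n$ must divide $w$, so both $a$ and
  -- $b$ are units.
  have key : a ^ n * w' = b ^ n * (u * w) := by
    apply FaithfulSMul.algebraMap_injective R L
    rw [map_mul, map_mul, ← h, ← hz, div_pow, map_pow, map_pow]
    field_simp
  have hbu : IsUnit b := by
    apply hw' b
    have h1 : b ^ n ∣ a ^ n * w' := key ▸ dvd_mul_right _ _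
    exact (hred.symm.pow).dvd_of_dvd_mul_left h1
  have hau : IsUnit a := by
    apply hw a
    have h1 : a ^ n ∣ b ^ n * (u * w) := key ▸ dvd_mul_right _ _
    exact hu.dvd_mul_left.1 ((hred.pow).dvd_of_dvd_mul_left h1)
  obtain ⟨c, hc⟩ := hbu.exists_right_inv
  refine ⟨a * c, hau.mul (IsUnit.of_mul_eq_one b (by rw [mul_comm, hc])), ?_⟩
  rw [← hz, map_mul, eq_div_iff hb0', mul_assoc, ← map_mul, mul_comm c, hc, map_one, mul_one]

end PowerFree

/-! ### Crossed homomorphisms with values in permutation modules -/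

/-- The first cohomology of a permutation module is trivial. -/
lemma exists_eq_sub_of_crossedHom {G : Type u} [Group G] [Finite G] {X : Type v} [MulAction G X]
    (f : G → X → ℤ) (hf : ∀ g h x, f (g * h) x = f g x + f h (g⁻¹ • x)) :
    ∃ D : X → ℤ, ∀ g x, f g x = D (g⁻¹ • x) - D x := by
  have := Fintype.ofFinite G
  let D' : X → ℤ := fun x => ∑ h, f h x
  have hn : (0 : ℤ) < Fintype.card G := by exact_mod_cast Fintype.card_pos
  have h1 : ∀ g x, Fintype.card G * f g x = D' x - D' (g⁻¹ • x) := by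
    intro g x
    have h2 : D' x = ∑ h, f (g * h) x := (Fintype.sum_equiv (Equiv.mulLeft g) _ _ fun h => rfl).symm
    rw [h2]
    simp_rw [hf, D']
    rw [Finset.sum_add_distrib, Finset.sum_const, Finset.card_univ, nsmul_eq_mul]
    ring
  -- Averaging trivializes $|G|f$. The values $D'(x)$ and $D'(g^{-1}x)$ are congruent modulo $|G|$,
  -- so rounded division turns their difference into exactly $f(g,x)$.
  refine ⟨fun x => -(D' x / Fintype.card G), fun g x => ?_⟩
  have h3 : D' x = D' (g⁻¹ • x) + Fintype.card G * f g x := by rw [h1]; ring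
  beta_reduce
  rw [h3, Int.add_mul_ediv_left _ _ hn.ne']
  ring

/-! ### The characteristic class of the lattice `A₂(G)` -/

section Lattice

variable {G : Type u} [CommGroup G] {r : ℕ} {σ : Fin r → G}

lemma subOne_mul (g h : G) :
    subOne (g * h) = subOne g + MonoidAlgebra.of ℤ G g * subOne h := by
  rw [subOne, subOne, subOne, map_mul]; ring

lemma subOne_one : subOne (1 : G) = 0 := by rw [subOne, map_one, sub_self]

/-- By $gh-1=(g-1)+g(h-1)$, the elements $g$ with $g-1$ in the image form a subgroup, and it
contains every $\sigma_i$. -/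
lemma exists_jMap_eq_subOne (hσ : IsDirectProduct σ) (g : G) : ∃ p, jMap σ p = subOne g := by
  let H : Subgroup G :=
    { carrier := {g | ∃ p, jMap σ p = subOne g}
      one_mem' := ⟨0, by rw [map_zero, subOne_one]⟩
      mul_mem' := by
        rintro a b ⟨p, hp⟩ ⟨q, hq⟩
        exact ⟨p + MonoidAlgebra.of ℤ G a • q, by
          rw [map_add, map_smul, hp, hq, smul_eq_mul, subOne_mul]⟩
      inv_mem' := by
        rintro a ⟨p, hp⟩
        refine ⟨-(MonoidAlgebra.of ℤ G a⁻¹ • p), ?_⟩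
        have h := subOne_mul a⁻¹ a
        rw [inv_mul_cancel, subOne_one] at h
        rw [map_neg, map_smul, hp, smul_eq_mul]
        exact (eq_neg_of_add_eq_zero_left h.symm).symm }
  obtain ⟨x, rfl⟩ := hσ.2 g
  refine H.prod_mem fun i _ => ?_
  exact (Subgroup.zpowers_le.2 (show σ i ∈ H from ⟨_, jMap_dElt σ i⟩)) (x i).2

lemma exists_section (hσ : IsDirectProduct σ) :
    ∃ s : G → Fin r → MonoidAlgebra ℤ G, s 1 = 0 ∧ ∀ g, jMap σ (s g) = subOne g := by
  classical
  choose s hs using exists_jMap_eq_subOne hσ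
  refine ⟨Function.update s 1 0, by simp, fun g => ?_⟩
  by_cases h : g = 1
  · subst h
    simp [subOne_one]
  · rw [Function.update_of_ne h, hs]

/-- The `2`-cocycle with values in `A₂(G)` given by a section `s` of `P₂(G) → I[G]` over the elements
`g - 1`. -/
def latCocycle {s : G → Fin r → MonoidAlgebra ℤ G} (hs : ∀ g, jMap σ (s g) = subOne g) (g h : G) :
    A2 σ :=
  ⟨s (g * h) - s g - MonoidAlgebra.of ℤ G g • s h, by
    rw [LinearMap.mem_ker, map_sub, map_sub, map_smul, hs, hs, hs, subOne_mul, smul_eq_mul]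
    ring⟩

variable {s : G → Fin r → MonoidAlgebra ℤ G} (hs : ∀ g, jMap σ (s g) = subOne g)

lemma coe_latCocycle (g h : G) : (latCocycle hs g h : Fin r → MonoidAlgebra ℤ G)
    = s (g * h) - s g - MonoidAlgebra.of ℤ G g • s h := rfl

omit s in
lemma coe_nsmul_A2 (m : ℕ) (a : A2 σ) :
    ((m • a : A2 σ) : Fin r → MonoidAlgebra ℤ G) = m • (a : Fin r → MonoidAlgebra ℤ G) :=
  map_nsmul (A2 σ).subtype m a

lemma latCocycle_one_left (hs1 : s 1 = 0) (g : G) : latCocycle hs 1 g = 0 := by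
  apply Subtype.ext
  rw [coe_latCocycle, one_mul, hs1, map_one, one_smul]
  simp

/-- In $P_2(G)$ the cochain is the coboundary of $-s$, so the cocycle identity is automatic. -/
lemma latCocycle_assoc (h k g : G) :
    latCocycle hs h (k * g) + MonoidAlgebra.of ℤ G h • latCocycle hs k g
      = latCocycle hs h k + latCocycle hs (h * k) g := by
  apply Subtype.ext
  simp only [Submodule.coe_add, Submodule.coe_smul, coe_latCocycle, map_mul, smul_sub, mul_smul,
    mul_assoc]
  abel

variable [Finite G]

/-- The multiple by `|G|` of the class of `latCocycle` is trivial. -/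
lemma exists_latCochain : ∃ α : G → A2 σ, ∀ g h,
    α g + MonoidAlgebra.of ℤ G g • α h = Nat.card G • latCocycle hs g h + α (g * h) := by
  have := Fintype.ofFinite G
  let q : Fin r → MonoidAlgebra ℤ G := -∑ g, s g
  have hq : jMap σ q = (Nat.card G : MonoidAlgebra ℤ G) - ∑ g, MonoidAlgebra.of ℤ G g := by
    simp only [q, map_neg, map_sum, hs, subOne]
    rw [Finset.sum_sub_distrib, neg_sub, Finset.sum_const, Finset.card_univ,
      Nat.card_eq_fintype_card, nsmul_eq_mul, mul_one]
  have hN : ∀ g : G, subOne g * ∑ h, MonoidAlgebra.of ℤ G h = 0 := by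
    intro g
    rw [subOne, sub_mul, one_mul, Finset.mul_sum, sub_eq_zero]
    simp_rw [← map_mul]
    exact Fintype.sum_equiv (Equiv.mulLeft g) _ _ fun h => rfl
  -- The term $-|G|s$ has the right coboundary, and the crossed homomorphism $g\mapsto(g-1)q$ does
  -- not change it. It only moves the values into $A_2(G)$: $j(q)=|G|-N$ with $N$ the norm element,
  -- and $(g-1)N=0$.
  refine ⟨fun g => ⟨subOne g • q - Nat.card G • s g, ?_⟩, fun g h => ?_⟩
  · rw [LinearMap.mem_ker, map_sub, map_smul, map_nsmul, hq, hs, smul_eq_mul, mul_sub, hN,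
      nsmul_eq_mul]
    ring
  · apply Subtype.ext
    simp only [Submodule.coe_add, Submodule.coe_smul, coe_nsmul_A2, coe_latCocycle, subOne, map_mul,
      smul_sub, sub_smul, one_smul, mul_smul, smul_comm (MonoidAlgebra.of ℤ G g) (Nat.card G)]
    abel

/-- The class of `latCocycle` has order divisible by `|G|`. -/
lemma card_dvd_of_latCochain {m : ℕ} (α : G → A2 σ) (hα : ∀ g h,
    α g + MonoidAlgebra.of ℤ G g • α h = m • latCocycle hs g h + α (g * h)) : Nat.card G ∣ m := by
  have := Fintype.ofFinite G
  -- The coboundaries cancel, so $\beta$ is a crossed homomorphism into the permutation module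
  -- $P_2(G)$ and hence principal.
  let β : G → Fin r → MonoidAlgebra ℤ G := fun g => α g + m • s g
  have hβ : ∀ g h, β (g * h) = β g + MonoidAlgebra.of ℤ G g • β h := by
    intro g h
    have h1 := congrArg (Subtype.val) (hα g h)
    simp only [Submodule.coe_add, Submodule.coe_smul, coe_nsmul_A2, coe_latCocycle, smul_sub] at h1
    simp only [β, smul_add]
    rw [smul_comm (MonoidAlgebra.of ℤ G g) m, add_add_add_comm, h1]
    abel
  have hcoeff : ∀ (g x : G) (y : MonoidAlgebra ℤ G),
      (MonoidAlgebra.of ℤ G g * y).coeff x = y.coeff (g⁻¹ * x) := by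
    intro g x y
    rw [MonoidAlgebra.of_apply, MonoidAlgebra.coeff_single_mul_apply, one_mul]
  have hD := fun i => exists_eq_sub_of_crossedHom (fun g (x : G) => (β g i).coeff x) (by
    intro g h x
    rw [hβ, Pi.add_apply, MonoidAlgebra.coeff_add, Finsupp.add_apply, Pi.smul_apply, smul_eq_mul,
      hcoeff, smul_eq_mul])
  choose D hD using hD
  let q : Fin r → MonoidAlgebra ℤ G := fun i =>
    MonoidAlgebra.ofCoeff (Finsupp.equivFunOnFinite.symm (D i))
  have hq : ∀ g, β g = subOne g • q := by
    intro g
    funext i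
    ext x
    have h1 : ∀ x, (q i).coeff x = D i x := fun x => rfl
    rw [hD i g x, Pi.smul_apply, smul_eq_mul, smul_eq_mul, subOne, sub_mul, one_mul, MonoidAlgebra.coeff_sub,
      Finsupp.sub_apply, hcoeff, h1, h1]
  have hj : ∀ g, subOne g * (jMap σ q - (m : MonoidAlgebra ℤ G)) = 0 := by
    intro g
    have h1 : jMap σ (β g) = m * subOne g := by
      have h2 : jMap σ (α g) = 0 := (α g).2
      rw [show β g = α g + m • s g from rfl, map_add, h2, map_nsmul, hs, nsmul_eq_mul, zero_add]
    rw [hq, map_smul, smul_eq_mul] at h1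
    rw [mul_sub, h1]; ring
  let ε : MonoidAlgebra ℤ G →+* ℤ :=
    (MonoidAlgebra.lift ℤ ℤ G (1 : G →* ℤ)).toRingHom
  have hε : ∀ y, ε y = ∑ g, y.coeff g := by
    intro y
    change MonoidAlgebra.lift ℤ ℤ G (1 : G →* ℤ) y = _
    rw [MonoidAlgebra.lift_apply, Finsupp.sum_fintype _ _ (by simp)]
    simp
  have hε0 : ∀ g : G, ε (subOne g) = 0 := by
    intro g
    rw [subOne, map_sub, map_one, sub_eq_zero]
    change MonoidAlgebra.lift ℤ ℤ G (1 : G →* ℤ) _ = _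
    simp
  -- An element annihilated by every $g-1$ has constant coefficients, so its augmentation is
  -- divisible by $|G|$. That augmentation is $-m$, because $j(q)$ lies in $I[G]$.
  have hconst : ∀ g, (jMap σ q - (m : MonoidAlgebra ℤ G)).coeff g = (jMap σ q - (m : MonoidAlgebra ℤ G)).coeff 1 := by
    intro g
    have h1 := congrArg (fun y => MonoidAlgebra.coeff y g) (hj g)
    simp only [subOne, sub_mul, one_mul, MonoidAlgebra.coeff_sub, Finsupp.sub_apply, hcoeff,
      MonoidAlgebra.coeff_zero, Finsupp.zero_apply, inv_mul_cancel] at h1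
    rw [MonoidAlgebra.coeff_sub, Finsupp.sub_apply, Finsupp.sub_apply]
    linarith
  have h1 : ε (jMap σ q - (m : MonoidAlgebra ℤ G)) = -m := by
    rw [map_sub, map_natCast, jMap_apply, map_sum]
    simp [hε0]
  have h2 := hε (jMap σ q - (m : MonoidAlgebra ℤ G))
  simp_rw [hconst] at h2
  rw [h1, Finset.sum_const, Finset.card_univ, nsmul_eq_mul] at h2
  rw [Nat.card_eq_fintype_card, ← Int.natCast_dvd_natCast]
  exact ⟨-(jMap σ q - (m : MonoidAlgebra ℤ G)).coeff 1, by rw [mul_neg, ← h2, neg_neg]⟩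

/-- The coefficients of an element of `A₂(G)`. -/
def coeffA2 : A2 σ →ₗ[ℤ] (Fin r → G → ℤ) :=
  AddMonoidHom.toIntLinearMap
    { toFun := fun a i g => ((a : Fin r → MonoidAlgebra ℤ G) i).coeff g
      map_zero' := by
        funext i g
        simp
      map_add' := fun a b => by
        funext i g
        simp }

omit [Finite G] in
lemma coeffA2_injective : Function.Injective (coeffA2 (σ := σ)) := by
  intro a b h
  apply Subtype.ext
  funext i
  apply MonoidAlgebra.coeff_injective
  ext g
  exact congrFun (congrFun h i) g

instance : Module.Finite ℤ (A2 σ) := Module.Finite.of_injective coeffA2 coeffA2_injective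

instance : Module.Free ℤ (A2 σ) :=
  Module.Free.of_equiv (LinearEquiv.ofInjective coeffA2 coeffA2_injective).symm

instance (F : Type*) [Field F] : UniqueFactorizationMonoid (AddMonoidAlgebra F (A2 σ)) :=
  uniqueFactorizationMonoid_addMonoidAlgebra F (A2 σ)

end Lattice

/-! ### The cocycle of the generic crossed product -/

section GenericField

variable (F : Type v) [Field F] {G : Type u} [CommGroup G] {r : ℕ} {σ : Fin r → G}

lemma e_zero : e F σ 0 = 1 := by
  rw [e, ← AddMonoidAlgebra.one_def, map_one]

lemma e_add (a b : A2 σ) : e F σ (a + b) = e F σ a * e F σ b := by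
  rw [e, e, e, ← map_mul, AddMonoidAlgebra.single_mul_single, mul_one]

lemma e_ne_zero (a : A2 σ) : e F σ a ≠ 0 := by
  intro h
  have := e_add F a (-a)
  rw [h, zero_mul, add_neg_cancel, e_zero] at this
  exact one_ne_zero this

lemma e_nsmul (m : ℕ) (a : A2 σ) : e F σ (m • a) = e F σ a ^ m := by
  induction m with
  | zero => rw [zero_smul, e_zero, pow_zero]
  | succ m ih => rw [succ_nsmul, e_add, ih, pow_succ]

lemma e_sum {ι : Type*} (S : Finset ι) (a : ι → A2 σ) :
    e F σ (∑ i ∈ S, a i) = ∏ i ∈ S, e F σ (a i) := by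
  classical
  induction S using Finset.induction_on with
  | empty => simp [e_zero]
  | insert i S hi ih => rw [Finset.sum_insert hi, Finset.prod_insert hi, e_add, ih]

lemma algebraMap_injective :
    Function.Injective (algebraMap (AddMonoidAlgebra F (A2 σ)) (L0 F σ)) :=
  IsFractionRing.injective _ _

lemma e_injective : Function.Injective (e F σ) := fun _ _ h =>
  AddMonoidAlgebra.single_left_injective one_ne_zero (algebraMap_injective F h)

variable [MulSemiringAction G F]

lemma smul_e (g : G) (a : A2 σ) : g • e F σ a = e F σ (MonoidAlgebra.of ℤ G g • a) := by
  rw [e, smul_algebraMap, ringAct_single, smul_one, e]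

/-- `G` acts faithfully on `L₀` unless it is cyclic. -/
lemma faithfulSMul_L0 (hG : ¬ IsCyclic G) (hσ : IsDirectProduct σ) : FaithfulSMul G (L0 F σ) := by
  have hcyc : ∀ c : G, ¬ ∀ j, σ j ∈ Subgroup.zpowers c := by
    intro c hc
    apply hG
    refine ⟨c, fun g => ?_⟩
    obtain ⟨x, rfl⟩ := hσ.2 g
    exact Subgroup.prod_mem _ fun j _ => (Subgroup.zpowers_le.2 (hc j)) (x j).2
  obtain ⟨i, hi⟩ : ∃ i, σ i ≠ 1 := by
    by_contra h
    push Not at h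
    exact hcyc 1 fun j => by rw [h j]; exact Subgroup.one_mem _
  obtain ⟨j, hij⟩ : ∃ j, j ≠ i := by
    by_contra h
    push Not at h
    exact hcyc (σ i) fun j => by rw [h j]; exact Subgroup.mem_zpowers _
  refine ⟨fun {g h} hgh => ?_⟩
  have h1 := hgh (e F σ (uLat σ i j))
  rw [smul_e, smul_e] at h1
  have h2 := congrFun (congrArg Subtype.val (e_injective F h1)) j
  have h3 : ((uLat σ i j : A2 σ) : Fin r → MonoidAlgebra ℤ G) j = subOne (σ i) := by
    simp [uLat, dElt, hij]
  rw [Submodule.coe_smul, Submodule.coe_smul, Pi.smul_apply, Pi.smul_apply, h3, subOne,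
    smul_eq_mul, smul_eq_mul, mul_sub, mul_sub, ← map_mul, ← map_mul, mul_one, mul_one] at h2
  -- In $g(\sigma_i-1)=h(\sigma_i-1)$ the coefficient at $g$ is $-1$ on the left, while for $h\ne g$
  -- it is $0$ or $1$ on the right.
  have h4 := congrArg (fun y => MonoidAlgebra.coeff y g) h2
  classical
  simp only [MonoidAlgebra.coeff_sub, MonoidAlgebra.of_apply, MonoidAlgebra.coeff_single,
    Finsupp.sub_apply, Finsupp.single_apply, mul_eq_left, hi, if_true, if_false] at h4
  by_contra hne
  rw [if_neg (Ne.symm hne)] at h4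
  split_ifs at h4
  · omega
  · omega

variable {s : G → Fin r → MonoidAlgebra ℤ G} (hs : ∀ g, jMap σ (s g) = subOne g)

/-- The cocycle of the generic crossed product. -/
def genericCocycle (g h : G) : L0 F σ := e F σ (latCocycle hs g h)

lemma isCocycle_genericCocycle (hs1 : s 1 = 0) : IsCocycle (genericCocycle F hs) where
  ne_zero _ _ := e_ne_zero F _
  one_left k := by rw [genericCocycle, latCocycle_one_left hs hs1, e_zero]
  assoc h k g := by
    simp only [genericCocycle]
    rw [smul_e, ← e_add, ← e_add, latCocycle_assoc]

variable [Finite G]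

lemma isCobdry_genericCocycle_pow_card :
    IsCobdry fun g h => genericCocycle F hs g h ^ Nat.card G := by
  obtain ⟨α, hα⟩ := exists_latCochain hs
  refine ⟨fun g => e F σ (α g), fun g => e_ne_zero F _, fun g h => ?_⟩
  rw [smul_e, ← e_add, hα, e_add, e_nsmul]
  rfl

/-- Changing the cochain by a coboundary makes its values units of $F[A_2(G)]$, hence of the form
$c\cdot e(\alpha)$. Comparing exponents moves the relation into the lattice. -/
lemma card_dvd_of_isCobdry {m : ℕ} (hm : IsCobdry fun g h => genericCocycle F hs g h ^ m) :
    Nat.card G ∣ m := by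
  have := Fintype.ofFinite G
  obtain ⟨a, ha0, ha⟩ := hm
  let y : L0 F σ := ∏ h, a h
  have hy0 : y ≠ 0 := Finset.prod_ne_zero_iff.2 fun h _ => ha0 h
  -- Take the product of the coboundary relation over all $h$: up to a monomial, $a(g)^{|G|}$ is
  -- $y/g(y)$.
  have hy : ∀ g, a g ^ Nat.card G * g • y = e F σ (m • ∑ h, latCocycle hs g h) * y := by
    intro g
    have h1 : y = ∏ h, a (g * h) := (Fintype.prod_equiv (Equiv.mulLeft g) _ _ fun h => rfl).symm
    rw [Nat.card_eq_fintype_card, ← Finset.card_univ, ← Finset.prod_const, Finset.smul_prod',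
      ← Finset.prod_mul_distrib]
    simp_rw [ha]
    rw [Finset.prod_mul_distrib, ← h1, Finset.smul_sum, e_sum]
    simp_rw [e_nsmul, genericCocycle]
  obtain ⟨Y, w, hY0, hYw, hw⟩ :=
    exists_eq_pow_mul_algebraMap_powerFree (R := AddMonoidAlgebra F (A2 σ))
      (Nat.card_pos (α := G)) y hy0
  have hgY0 : ∀ g : G, g • Y ≠ 0 := fun g => (smul_ne_zero_iff_ne g).2 hY0
  -- With $n=|G|$ and $y=Y^nw$, this cohomologous cochain satisfies $z(g)^n\,g(w)=\text{unit}\cdot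
  -- w$ with $w$ and $g(w)$ both $n$-th-power free, so $z(g)$ is a unit.
  let z : G → L0 F σ := fun g => a g * g • Y / Y
  have hpf : ∀ g b, b ^ Nat.card G ∣ ringAct F σ g w → IsUnit b := by
    intro g b hb
    have h1 := map_dvd (ringAct F σ g).symm hb
    rw [RingEquiv.symm_apply_apply, map_pow] at h1
    have h2 := (hw _ h1).map (ringAct F σ g)
    rwa [RingEquiv.apply_symm_apply] at h2
  have hz : ∀ g, ∃ v : AddMonoidAlgebra F (A2 σ), IsUnit v ∧
      algebraMap (AddMonoidAlgebra F (A2 σ)) (L0 F σ) v = z g := by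
    intro g
    have hu : IsUnit (AddMonoidAlgebra.single (m • ∑ h, latCocycle hs g h) (1 : F)) := by
      refine IsUnit.of_mul_eq_one (AddMonoidAlgebra.single (-(m • ∑ h, latCocycle hs g h)) 1) ?_
      rw [AddMonoidAlgebra.single_mul_single, add_neg_cancel, mul_one, AddMonoidAlgebra.one_def]
    refine exists_isUnit_of_pow_mul_powerFree (n := Nat.card G) hu hw (hpf g) ?_
    have h1 := hy g
    rw [hYw, smul_mul', smul_algebraMap, smul_pow'] at h1
    rw [map_mul]
    change _ = e F σ _ * _
    have hYn := pow_ne_zero (Nat.card G) hY0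
    simp only [z]
    rw [div_pow, mul_pow, div_mul_eq_mul_div, div_eq_iff hYn, mul_assoc, h1]
    ring
  choose v hvu hv using hz
  choose α c hc hvα using fun g => exists_single_of_isUnit (hvu g)
  have hzmul : ∀ g h, z g * g • z h = e F σ (m • latCocycle hs g h) * z (g * h) := by
    intro g h
    have h1 := ha g h
    simp only [z, smul_mul', div_eq_mul_inv, smul_inv'', smul_smul]
    have h2 := hgY0 g
    calc _ = (a g * g • a h) * (g * h) • Y * Y⁻¹ * (g • Y * (g • Y)⁻¹) := by ring
      _ = _ := by
        rw [mul_inv_cancel₀ h2, h1, e_nsmul]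
        simp only [genericCocycle]
        ring
  refine card_dvd_of_latCochain hs α fun g h => ?_
  have h1 := hzmul g h
  rw [← hv, ← hv, ← hv, smul_algebraMap, e, ← map_mul, ← map_mul] at h1
  have h2 := algebraMap_injective F h1
  rw [hvα, hvα h, hvα (g * h), ringAct_single, AddMonoidAlgebra.single_mul_single,
    AddMonoidAlgebra.single_mul_single, AddMonoidAlgebra.single_inj] at h2
  rcases h2 with h2 | h2
  · exact h2.1
  · exact absurd h2.1 (mul_ne_zero (hc g) ((smul_ne_zero_iff_ne g).2 (hc h)))

end GenericField

/-! ### Upper bound for the dimension of an abelian crossed product -/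

section Spanning

variable {G : Type u} [CommGroup G] {L : Type v} [Field L] [MulSemiringAction G L] {r : ℕ}
  (σ : Fin r → G) (u : Fin r → Fin r → L) (b : Fin r → L)

/-- The canonical homomorphism from `L` to the abelian crossed product. -/
def coeffHom : L →ₐ[FixedPoints.subfield G L] AbelianCrossedProduct L σ u b where
  toFun x := RingQuot.mkAlgHom _ (Rel L σ u b) (FreeAlgebra.ι _ (Sum.inl x))
  map_one' := by
    have h := RingQuot.mkAlgHom_rel (FixedPoints.subfield G L)
      (Rel.scalar (σ := σ) (u := u) (b := b) 1)
    rw [map_one, map_one] at h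
    exact h
  map_mul' x y := by
    rw [← map_mul]
    exact RingQuot.mkAlgHom_rel _ (Rel.mul x y)
  map_zero' := by
    have h := RingQuot.mkAlgHom_rel (FixedPoints.subfield G L)
      (Rel.scalar (σ := σ) (u := u) (b := b) 0)
    rw [map_zero, map_zero] at h
    exact h
  map_add' x y := by
    rw [← map_add]
    exact RingQuot.mkAlgHom_rel _ (Rel.add x y)
  commutes' k := by
    have h := RingQuot.mkAlgHom_rel (FixedPoints.subfield G L)
      (Rel.scalar (σ := σ) (u := u) (b := b) k)
    rw [AlgHom.commutes] at h
    exact h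

/-- The generator `z_i` of the abelian crossed product. -/
def zGen (i : Fin r) : AbelianCrossedProduct L σ u b :=
  RingQuot.mkAlgHom (FixedPoints.subfield G L) (Rel L σ u b) (FreeAlgebra.ι _ (Sum.inr i))

lemma zGen_mul_coeffHom (i : Fin r) (x : L) :
    zGen σ u b i * coeffHom σ u b x = coeffHom σ u b (σ i • x) * zGen σ u b i := by
  have h := RingQuot.mkAlgHom_rel (FixedPoints.subfield G L)
    (Rel.conj (σ := σ) (u := u) (b := b) i x)
  rw [map_mul, map_mul] at h
  exact h

lemma zGen_mul_zGen (i j : Fin r) : zGen σ u b i * zGen σ u b j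
    = coeffHom σ u b (u i j) * (zGen σ u b j * zGen σ u b i) := by
  have h := RingQuot.mkAlgHom_rel (FixedPoints.subfield G L)
    (Rel.comm (σ := σ) (u := u) (b := b) i j)
  rw [map_mul, map_mul, map_mul] at h
  exact h

lemma zGen_pow (i : Fin r) : zGen σ u b i ^ orderOf (σ i) = coeffHom σ u b (b i) := by
  have h := RingQuot.mkAlgHom_rel (FixedPoints.subfield G L)
    (Rel.pow (σ := σ) (u := u) (b := b) i)
  rw [map_pow] at h
  exact h

lemma crossedProduct_induction (p : AbelianCrossedProduct L σ u b → Prop)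
    (hcoeff : ∀ x, p (coeffHom σ u b x)) (hz : ∀ i, p (zGen σ u b i))
    (hmul : ∀ x y, p x → p y → p (x * y)) (hadd : ∀ x y, p x → p y → p (x + y)) (q) : p q := by
  obtain ⟨q, rfl⟩ := RingQuot.mkAlgHom_surjective (FixedPoints.subfield G L) (Rel L σ u b) q
  induction q using FreeAlgebra.induction with
  | grade0 k =>
    rw [AlgHom.commutes, ← AlgHom.commutes (coeffHom σ u b)]
    exact hcoeff _
  | grade1 x =>
    cases x with
    | inl x => exact hcoeff x
    | inr i => exact hz i
  | mul x y hx hy => rw [map_mul]; exact hmul _ _ hx hy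
  | add x y hx hy => rw [map_add]; exact hadd _ _ hx hy

/-- The `L`-line through an element of the crossed product. -/
def line (w : AbelianCrossedProduct L σ u b) :
    Submodule (FixedPoints.subfield G L) (AbelianCrossedProduct L σ u b) :=
  LinearMap.range ((LinearMap.mulRight (FixedPoints.subfield G L) w).comp
    (coeffHom σ u b).toLinearMap)

variable {σ u b}

lemma mem_line {w q : AbelianCrossedProduct L σ u b} :
    q ∈ line σ u b w ↔ ∃ x, coeffHom σ u b x * w = q := Iff.rfl

/-- Coefficients can be moved to the left past $w$, so monomials in the $z_i$ may be computed as
products of lines, ignoring coefficients. -/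
lemma line_mul_line {w w' : AbelianCrossedProduct L σ u b} {g : G}
    (hw : ∀ x, w * coeffHom σ u b x = coeffHom σ u b (g • x) * w) :
    line σ u b w * line σ u b w' = line σ u b (w * w') := by
  apply le_antisymm
  · rw [Submodule.mul_le]
    rintro _ ⟨x, rfl⟩ _ ⟨y, rfl⟩
    refine mem_line.2 ⟨x * g • y, ?_⟩
    change _ = coeffHom σ u b x * w * (coeffHom σ u b y * w')
    rw [map_mul, mul_assoc, ← mul_assoc _ w w', ← hw]
    simp only [mul_assoc]
  · rintro _ ⟨x, rfl⟩
    change coeffHom σ u b x * (w * w') ∈ _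
    rw [← mul_assoc]
    exact Submodule.mul_mem_mul (mem_line.2 ⟨x, rfl⟩) (mem_line.2 ⟨1, by rw [map_one, one_mul]⟩)

lemma one_conj (x : L) : (1 : AbelianCrossedProduct L σ u b) * coeffHom σ u b x
    = coeffHom σ u b ((1 : G) • x) * 1 := by
  rw [one_smul, one_mul, mul_one]

lemma line_coeffHom {c : L} (hc : c ≠ 0) : line σ u b (coeffHom σ u b c) = line σ u b 1 := by
  apply le_antisymm
  · rintro _ ⟨x, rfl⟩
    exact mem_line.2 ⟨x * c, by rw [map_mul, mul_one]; rfl⟩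
  · rintro _ ⟨x, rfl⟩
    refine mem_line.2 ⟨x * c⁻¹, ?_⟩
    rw [← map_mul, mul_assoc, inv_mul_cancel₀ hc, mul_one]
    change _ = coeffHom σ u b x * 1
    rw [mul_one]

lemma line_zGen_mul_comm_le (i j : Fin r) :
    line σ u b (zGen σ u b i) * line σ u b (zGen σ u b j)
      ≤ line σ u b (zGen σ u b j) * line σ u b (zGen σ u b i) := by
  rw [line_mul_line (zGen_mul_coeffHom σ u b i), line_mul_line (zGen_mul_coeffHom σ u b j)]
  rintro _ ⟨x, rfl⟩
  refine mem_line.2 ⟨x * u i j, ?_⟩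
  rw [map_mul, mul_assoc, ← zGen_mul_zGen]
  rfl

lemma line_zGen_pow (i : Fin r) (k : ℕ) :
    line σ u b (zGen σ u b i) ^ (k + 1) = line σ u b (zGen σ u b i ^ (k + 1)) := by
  induction k with
  | zero => simp
  | succ k ih =>
    rw [pow_succ', ih, line_mul_line (zGen_mul_coeffHom σ u b i), ← pow_succ']

variable [Finite G]

open scoped IsMulCommutative in
-- The lines $Lz_i$ commute as submodules although the $z_i$ do not, and $(Lz_i)^{n_i}=L$. So the
-- $|G|$ lines of reduced monomials span, and each has dimension at most $[L:L^G]\le|G|$.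
lemma finite_and_finrank_le_crossedProduct (hσ : IsDirectProduct σ) (hb : ∀ i, b i ≠ 0) :
    FiniteDimensional (FixedPoints.subfield G L) (AbelianCrossedProduct L σ u b) ∧
    Module.finrank (FixedPoints.subfield G L) (AbelianCrossedProduct L σ u b) ≤ Nat.card G ^ 2 := by
  have := Fintype.ofFinite G
  let Λ := line σ u b 1
  let P : Fin r → Submodule (FixedPoints.subfield G L) (AbelianCrossedProduct L σ u b) :=
    fun i => line σ u b (zGen σ u b i)
  have hΛΛ : Λ * Λ = Λ := by
    simp only [Λ]
    rw [line_mul_line one_conj, one_mul]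
  have hΛP : ∀ i, Λ * P i = P i := fun i => by
    simp only [Λ, P]
    rw [line_mul_line one_conj, one_mul]
  have hPΛ : ∀ i, P i * Λ = P i := fun i => by
    simp only [Λ, P]
    rw [line_mul_line (zGen_mul_coeffHom σ u b i), mul_one]
  have hPn : ∀ i, P i ^ orderOf (σ i) = Λ := by
    intro i
    have hpos := orderOf_pos (σ i)
    obtain ⟨k, hk⟩ : ∃ k, orderOf (σ i) = k + 1 := ⟨orderOf (σ i) - 1, by omega⟩
    simp only [P, Λ]
    rw [hk, line_zGen_pow, ← hk, zGen_pow, line_coeffHom (hb i)]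
  let S : Set (Submodule (FixedPoints.subfield G L) (AbelianCrossedProduct L σ u b)) :=
    insert Λ (Set.range P)
  have hcomm : ∀ x ∈ S, ∀ y ∈ S, x * y = y * x := by
    rintro x (rfl | ⟨i, rfl⟩) y (rfl | ⟨j, rfl⟩)
    · rfl
    · rw [hΛP, hPΛ]
    · rw [hΛP, hPΛ]
    · exact le_antisymm (line_zGen_mul_comm_le i j) (line_zGen_mul_comm_le j i)
  have := Submonoid.isMulCommutative_closure _ hcomm
  -- Only an inclusion, because the unit of the monoid of submodules is the line over the fixed
  -- field, not over $L$.
  have hline : ∀ N ∈ Submonoid.closure S, ∃ (w : AbelianCrossedProduct L σ u b) (g : G),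
      (∀ x, w * coeffHom σ u b x = coeffHom σ u b (g • x) * w) ∧ N ≤ line σ u b w := by
    intro N hN
    induction hN using Submonoid.closure_induction with
    | mem N hN =>
      rcases hN with rfl | ⟨i, rfl⟩
      · exact ⟨1, 1, one_conj, le_rfl⟩
      · exact ⟨_, _, zGen_mul_coeffHom σ u b i, le_rfl⟩
    | one =>
      refine ⟨1, 1, one_conj, ?_⟩
      rw [Submodule.one_le]
      exact mem_line.2 ⟨1, by rw [map_one, one_mul]⟩
    | mul N N' _ _ hN hN' =>
      obtain ⟨w, g, hw, hle⟩ := hN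
      obtain ⟨w', g', hw', hle'⟩ := hN'
      refine ⟨w * w', g * g', fun x => ?_, (mul_le_mul' hle hle').trans
        (line_mul_line hw).le⟩
      rw [mul_assoc, hw', ← mul_assoc, hw, mul_assoc, mul_smul]
  let l : Submonoid.closure S := ⟨Λ, Submonoid.subset_closure (Or.inl rfl)⟩
  let p : Fin r → Submonoid.closure S := fun i =>
    ⟨P i, Submonoid.subset_closure (Or.inr ⟨i, rfl⟩)⟩
  have hll : l * l = l := Subtype.ext hΛΛ
  have hllpow : ∀ k, l * l ^ k = l := by
    intro k
    induction k with
    | zero => rw [pow_zero, mul_one]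
    | succ k ih => rw [pow_succ, ← mul_assoc, ih, hll]
  have hpn : ∀ i, p i ^ orderOf (σ i) = l := fun i => Subtype.ext (hPn i)
  -- The leading factor $L$ absorbs each $(Lz_i)^{n_i}=L$, so exponents count only modulo $n_i$.
  let M : (Fin r → ℕ) → Submonoid.closure S := fun c => l * ∏ i, p i ^ c i
  have hMmod : ∀ c, M c = M fun i => c i % orderOf (σ i) := by
    intro c
    have h1 : ∀ i, p i ^ c i = l ^ (c i / orderOf (σ i)) * p i ^ (c i % orderOf (σ i)) := by
      intro i
      rw [← hpn i, ← pow_mul, ← pow_add, Nat.div_add_mod]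
    simp only [M]
    simp_rw [h1]
    rw [Finset.prod_mul_distrib, Finset.prod_pow_eq_pow_sum, ← mul_assoc, hllpow]
  have hMl : ∀ c, M c * l = M c := by
    intro c
    simp only [M]
    rw [mul_right_comm, hll]
  have hMp : ∀ c j, M c * p j = M (c + Pi.single j 1) := by
    intro c j
    simp only [M, Pi.add_apply, pow_add, Finset.prod_mul_distrib]
    rw [mul_assoc]
    congr 2
    rw [Finset.prod_eq_single j]
    · simp
    · intro i _ hij
      simp [Pi.single_eq_of_ne hij]
    · simp
  let I := (i : Fin r) → Fin (orderOf (σ i))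
  let T : Submodule (FixedPoints.subfield G L) (AbelianCrossedProduct L σ u b) :=
    ⨆ c : I, (M fun i => c i : Submodule (FixedPoints.subfield G L) (AbelianCrossedProduct L σ u b))
  have hMT : ∀ c, (M c : Submodule (FixedPoints.subfield G L) (AbelianCrossedProduct L σ u b))
      ≤ T := by
    intro c
    rw [hMmod c]
    exact le_iSup (fun c : I => (M fun i => c i : Submodule (FixedPoints.subfield G L)
      (AbelianCrossedProduct L σ u b)))
      (fun i => ⟨c i % orderOf (σ i), Nat.mod_lt _ (orderOf_pos _)⟩)
  have hTΛ : T * Λ ≤ T := by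
    simp only [T, Submodule.iSup_mul]
    refine iSup_le fun c => ?_
    have h1 : (M fun i => c i : Submodule (FixedPoints.subfield G L)
      (AbelianCrossedProduct L σ u b)) * Λ = _ := congrArg Subtype.val (hMl fun i => c i)
    rw [h1]
    exact hMT _
  have hTP : ∀ j, T * P j ≤ T := by
    intro j
    simp only [T, Submodule.iSup_mul]
    refine iSup_le fun c => ?_
    have h1 : (M fun i => c i : Submodule (FixedPoints.subfield G L)
      (AbelianCrossedProduct L σ u b)) * P j = _ := congrArg Subtype.val (hMp (fun i => c i) j)
    rw [h1]
    exact hMT _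
  have hT1 : (1 : AbelianCrossedProduct L σ u b) ∈ T := by
    apply hMT 0
    have h1 : M 0 = l := by simp [M]
    rw [h1]
    exact mem_line.2 ⟨1, by rw [map_one, one_mul]⟩
  -- The span contains $1$ and is stable under right multiplication by the generators, so it is the
  -- whole algebra.
  have hTall : ∀ q, ∀ t ∈ T, t * q ∈ T := by
    intro q
    induction q using crossedProduct_induction with
    | hcoeff x =>
      intro t ht
      exact hTΛ (Submodule.mul_mem_mul ht (mem_line.2 ⟨x, by rw [mul_one]⟩))
    | hz i =>
      intro t ht
      exact hTP i (Submodule.mul_mem_mul ht (mem_line.2 ⟨1, by rw [map_one, one_mul]⟩))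
    | hmul x y hx hy =>
      intro t ht
      rw [← mul_assoc]
      exact hy _ (hx _ ht)
    | hadd x y hx hy =>
      intro t ht
      rw [mul_add]
      exact T.add_mem (hx _ ht) (hy _ ht)
  choose w g hw hMw using fun c : I => hline _ (M fun i => c i).2
  let Φ : (I → L) →ₗ[FixedPoints.subfield G L] AbelianCrossedProduct L σ u b :=
    ∑ c : I, ((LinearMap.mulRight (FixedPoints.subfield G L) (w c)).comp
      (coeffHom σ u b).toLinearMap).comp (LinearMap.proj c)
  have hΦ : LinearMap.range Φ = ⊤ := by
    rw [eq_top_iff]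
    intro q _
    have hq : q ∈ T := by simpa using hTall q 1 hT1
    have hTΦ : T ≤ LinearMap.range Φ := by
      refine iSup_le fun c => (hMw c).trans ?_
      classical
      rintro _ ⟨x, rfl⟩
      refine ⟨Pi.single c x, ?_⟩
      simp only [Φ, LinearMap.sum_apply]
      rw [Finset.sum_eq_single c]
      · simp
      · intro d _ hd
        simp [Pi.single_eq_of_ne hd]
      · simp
    exact hTΦ hq
  have hfin : FiniteDimensional (FixedPoints.subfield G L) (AbelianCrossedProduct L σ u b) :=
    Module.Finite.of_surjective Φ (LinearMap.range_eq_top.1 hΦ)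
  refine ⟨hfin, ?_⟩
  have hI : Fintype.card I = Nat.card G := by
    rw [← Nat.card_congr (Equiv.ofBijective _ hσ), Nat.card_pi, Fintype.card_pi]
    refine Finset.prod_congr rfl fun i _ => ?_
    rw [Fintype.card_fin, Nat.card_zpowers]
  have h1 := LinearMap.finrank_range_le Φ
  rw [hΦ, finrank_top, Module.finrank_pi_fintype, Finset.sum_const, Finset.card_univ, hI,
    smul_eq_mul] at h1
  have h2 := FixedPoints.finrank_le_card G L
  rw [← Nat.card_eq_fintype_card] at h2
  calc _ ≤ _ := h1
    _ ≤ Nat.card G * Nat.card G := Nat.mul_le_mul_left _ h2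
    _ = _ := (sq _).symm

end Spanning

/-! ### The matrix representation of the generic crossed product -/

section TwistedMatrices

variable {G : Type u} [Group G] [Fintype G] [DecidableEq G] {L : Type v} [Field L]
  [MulSemiringAction G L]

/-- The matrices that commute with the semilinear operators given by `t`. -/
def twistedMatrices (t : G → G → L) : Subalgebra (FixedPoints.subfield G L) (Matrix G G L) where
  carrier := {M | ∀ h k g, M (h * k) (h * g) * t h g = t h k * h • M k g}
  add_mem' := by
    intro M N hM hN h k g
    rw [Matrix.add_apply, Matrix.add_apply, add_mul, hM, hN, smul_add, mul_add]
  mul_mem' := by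
    intro M N hM hN h k g
    rw [Matrix.mul_apply, Matrix.mul_apply, Finset.sum_mul, Finset.smul_sum, Finset.mul_sum]
    refine (Fintype.sum_equiv (Equiv.mulLeft h) _ _ fun l => ?_).symm
    rw [Equiv.coe_mulLeft, mul_assoc, hN, smul_mul', ← mul_assoc, ← hM, mul_assoc]
  algebraMap_mem' := by
    intro c h k g
    rw [Matrix.algebraMap_matrix_apply, Matrix.algebraMap_matrix_apply]
    by_cases hkg : k = g
    · subst hkg
      rw [if_pos rfl, if_pos rfl, mul_comm]
      congr 1
      exact (c.2 h).symm
    · rw [if_neg hkg, if_neg (by simpa using hkg), smul_zero, mul_zero, zero_mul]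

end TwistedMatrices

section Model

variable (F : Type v) [Field F] {G : Type u} [CommGroup G] {r : ℕ} {σ : Fin r → G}
  {s : G → Fin r → MonoidAlgebra ℤ G} (hs : ∀ g, jMap σ (s g) = subOne g)

include hs in
-- Pairs $(p,g)$ with $j(p)=g-1$ form an extension of $G$ by $A_2(G)$. This is the exponent of the
-- entry at $(k,kg)$ in the matrix of $(p,g)$.
lemma monomial_mem {p : Fin r → MonoidAlgebra ℤ G} {g : G} (hp : jMap σ p = subOne g) (k : G) :
    MonoidAlgebra.of ℤ G k • p + s k - s (k * g) ∈ A2 σ := by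
  rw [LinearMap.mem_ker, map_sub, map_add, map_smul, hs, hs, hp, subOne_mul, smul_eq_mul]
  ring

variable [DecidableEq G]

/-- The monomial matrix that represents the element `(p, g)` of the extension of `G` by `A₂(G)`. -/
def monomial (p : Fin r → MonoidAlgebra ℤ G) (g : G) (hp : jMap σ p = subOne g) :
    Matrix G G (L0 F σ) :=
  Matrix.of fun k l => if l = k * g then e F σ ⟨_, monomial_mem hs hp k⟩ else 0

lemma monomial_congr {p q : Fin r → MonoidAlgebra ℤ G} {g h : G} (hp : jMap σ p = subOne g)
    (hq : jMap σ q = subOne h) (hpq : p = q) (hgh : g = h) :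
    monomial F hs p g hp = monomial F hs q h hq := by
  subst hpq hgh
  rfl

omit [DecidableEq G] in
lemma jMap_mul {p q : Fin r → MonoidAlgebra ℤ G} {g h : G} (hp : jMap σ p = subOne g)
    (hq : jMap σ q = subOne h) : jMap σ (p + MonoidAlgebra.of ℤ G g • q) = subOne (g * h) := by
  rw [map_add, map_smul, hp, hq, subOne_mul, smul_eq_mul]

variable [Fintype G]

/-- The terms $s(kg)$ telescope, which leaves the group law $(p,g)(q,h)=(p+gq,gh)$. -/
lemma monomial_mul {p q : Fin r → MonoidAlgebra ℤ G} {g h : G} (hp : jMap σ p = subOne g)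
    (hq : jMap σ q = subOne h) :
    monomial F hs p g hp * monomial F hs q h hq = monomial F hs _ (g * h) (jMap_mul hp hq) := by
  ext k l
  rw [Matrix.mul_apply, Finset.sum_eq_single (k * g)]
  · simp only [monomial, Matrix.of_apply, if_true, mul_assoc]
    split_ifs with hl
    · rw [← e_add]
      congr 1
      apply Subtype.ext
      simp only [Submodule.coe_add, map_mul, smul_add, mul_smul]
      abel
    · rw [mul_zero]
  · intro m _ hm
    simp [monomial, hm]
  · simp

variable [MulSemiringAction G F]

omit [Fintype G] in
lemma diagonal_e (a : A2 σ) :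
    Matrix.diagonal (fun k : G => k • e F σ a) = monomial F hs a 1
      ((LinearMap.mem_ker.1 a.2).trans subOne_one.symm) := by
  ext k l
  rw [Matrix.diagonal_apply]
  simp only [monomial, Matrix.of_apply, mul_one]
  by_cases h : k = l
  · subst h
    rw [if_pos rfl, if_pos rfl, smul_e]
    congr 1
    apply Subtype.ext
    simp
  · rw [if_neg h, if_neg (Ne.symm h)]

lemma monomial_pow {p : Fin r → MonoidAlgebra ℤ G} {g : G} (hp : jMap σ p = subOne g) (n : ℕ) :
    ∃ hn, monomial F hs p g hp ^ n
      = monomial F hs ((∑ k ∈ Finset.range n, MonoidAlgebra.of ℤ G (g ^ k)) • p) (g ^ n) hn := by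
  induction n with
  | zero =>
    refine ⟨by rw [Finset.sum_range_zero, zero_smul, map_zero, pow_zero, subOne_one], ?_⟩
    rw [pow_zero]
    have h := diagonal_e F hs (0 : A2 σ)
    simp only [e_zero, smul_one] at h
    rw [← Matrix.diagonal_one, h]
    exact monomial_congr F hs _ _ (by simp) (pow_zero g).symm
  | succ n ih =>
    obtain ⟨hn, h⟩ := ih
    have heq : (∑ k ∈ Finset.range n, MonoidAlgebra.of ℤ G (g ^ k)) • p
        + MonoidAlgebra.of ℤ G (g ^ n) • p
        = (∑ k ∈ Finset.range (n + 1), MonoidAlgebra.of ℤ G (g ^ k)) • p := by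
      rw [Finset.sum_range_succ, add_smul]
    refine ⟨?_, ?_⟩
    · rw [← heq, pow_succ]
      exact jMap_mul hn hp
    · rw [pow_succ, h, monomial_mul]
      exact monomial_congr F hs _ _ heq (pow_succ g n).symm

lemma monomial_mem_twistedMatrices {p : Fin r → MonoidAlgebra ℤ G} {g : G}
    (hp : jMap σ p = subOne g) :
    monomial F hs p g hp ∈ twistedMatrices (genericCocycle F hs) := by
  intro h k l
  simp only [monomial, Matrix.of_apply, mul_assoc, mul_right_inj]
  split_ifs with hl
  · subst hl
    simp only [genericCocycle]
    rw [smul_e, ← e_add, ← e_add]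
    congr 1
    apply Subtype.ext
    simp only [Submodule.coe_add, Submodule.coe_smul, coe_latCocycle, map_mul, smul_sub, smul_add,
      mul_smul]
    abel
  · rw [smul_zero, mul_zero, zero_mul]

lemma diagonal_mem_twistedMatrices {t : G → G → L0 F σ} (x : L0 F σ) :
    Matrix.diagonal (fun k : G => k • x) ∈ twistedMatrices t := by
  intro h k l
  rw [Matrix.diagonal_apply, Matrix.diagonal_apply]
  by_cases hkl : k = l
  · subst hkl
    rw [if_pos rfl, if_pos rfl, mul_smul, mul_comm]
  · rw [if_neg hkl, if_neg (by simpa using hkl), smul_zero, mul_zero, zero_mul]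

/-- The representation of the generic crossed product by matrices over `L₀`. -/
def genericRep : GenericCrossedProduct F σ →ₐ[FixedPoints.subfield G (L0 F σ)]
    Matrix G G (L0 F σ) :=
  RingQuot.liftAlgHom (FixedPoints.subfield G (L0 F σ))
    ⟨FreeAlgebra.lift (FixedPoints.subfield G (L0 F σ)) (Sum.elim
      (fun x => Matrix.diagonal fun k : G => k • x)
      (fun i => monomial F hs (dElt r i) (σ i) (jMap_dElt σ i))), by
      intro x y hxy
      cases hxy with
      | add x y => simp [smul_add]
      | mul x y => simp [smul_mul']
      | scalar c =>
        simp only [FreeAlgebra.lift_ι_apply, Sum.elim_inl, AlgHom.commutes]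
        rw [Matrix.algebraMap_eq_diagonal]
        congr 1
        funext k
        exact c.2 k
      | conj i x =>
        simp only [map_mul, FreeAlgebra.lift_ι_apply, Sum.elim_inl, Sum.elim_inr]
        ext k l
        rw [Matrix.mul_diagonal, Matrix.diagonal_mul]
        simp only [monomial, Matrix.of_apply]
        split_ifs with hl
        · rw [hl, mul_smul, mul_comm]
        · rw [zero_mul, mul_zero]
      | comm i j =>
        simp only [map_mul, FreeAlgebra.lift_ι_apply, Sum.elim_inl, Sum.elim_inr]
        rw [monomial_mul, monomial_mul, diagonal_e F hs, monomial_mul]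
        -- In the extension the relation reads $d_i+\sigma_id_j=u_{ij}+d_j+\sigma_jd_i$.
        refine monomial_congr F hs _ _ ?_ (by rw [one_mul, mul_comm])
        simp only [uLat, subOne, map_one, one_smul, sub_smul]
        abel
      | pow i =>
        simp only [map_pow, FreeAlgebra.lift_ι_apply, Sum.elim_inl, Sum.elim_inr]
        obtain ⟨hn, h⟩ := monomial_pow F hs (jMap_dElt σ i) (orderOf (σ i))
        rw [h, diagonal_e F hs]
        exact monomial_congr F hs _ _ rfl (pow_orderOf_eq_one _)⟩

lemma genericRep_coeffHom (x : L0 F σ) :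
    genericRep F hs (coeffHom σ _ _ x) = Matrix.diagonal fun k : G => k • x := by
  change RingQuot.liftAlgHom _ _ (RingQuot.mkAlgHom _ _ _) = _
  rw [RingQuot.liftAlgHom_mkAlgHom_apply, FreeAlgebra.lift_ι_apply, Sum.elim_inl]

lemma genericRep_zGen (i : Fin r) :
    genericRep F hs (zGen σ _ _ i) = monomial F hs (dElt r i) (σ i) (jMap_dElt σ i) := by
  change RingQuot.liftAlgHom _ _ (RingQuot.mkAlgHom _ _ _) = _
  rw [RingQuot.liftAlgHom_mkAlgHom_apply, FreeAlgebra.lift_ι_apply, Sum.elim_inr]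

lemma genericRep_mem (q : GenericCrossedProduct F σ) :
    genericRep F hs q ∈ twistedMatrices (genericCocycle F hs) := by
  induction q using crossedProduct_induction with
  | hcoeff x => rw [genericRep_coeffHom]; exact diagonal_mem_twistedMatrices F x
  | hz i => rw [genericRep_zGen]; exact monomial_mem_twistedMatrices F hs _
  | hmul x y hx hy => rw [map_mul]; exact Subalgebra.mul_mem _ hx hy
  | hadd x y hx hy => rw [map_add]; exact Subalgebra.add_mem _ hx hy

lemma exists_genericRep_eq_monomial (hσ : IsDirectProduct σ) (g : G) :
    ∃ p hp q, genericRep F hs q = monomial F hs p g hp := by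
  let H : Submonoid G :=
    { carrier := {g | ∃ p hp q, genericRep F hs q = monomial F hs p g hp}
      one_mem' := ⟨_, _, coeffHom σ _ _ (e F σ 0), by
        rw [genericRep_coeffHom, diagonal_e F hs]⟩
      mul_mem' := by
        rintro a b ⟨p, hp, x, hx⟩ ⟨q, hq, y, hy⟩
        exact ⟨_, _, x * y, by rw [map_mul, hx, hy, monomial_mul]⟩ }
  obtain ⟨x, rfl⟩ := hσ.2 g
  refine H.prod_mem fun i _ => ?_
  have h1 : σ i ∈ H := ⟨_, _, zGen σ _ _ i, genericRep_zGen F hs i⟩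
  exact (Submonoid.powers_le.2 h1) (mem_powers_iff_mem_zpowers.2 (x i).2)

/-- Orbit vectors span $L_0^G$, so the span of the image contains every diagonal matrix times a
monomial matrix of each $g\in G$. These products include multiples of all matrix units. -/
lemma span_range_genericRep [FaithfulSMul G (L0 F σ)] (hσ : IsDirectProduct σ) :
    Submodule.span (L0 F σ) (Set.range (genericRep F hs)) = ⊤ := by
  have key : ∀ g (v : G → L0 F σ) p hp q, genericRep F hs q = monomial F hs p g hp →
      Matrix.diagonal v * monomial F hs p g hp
        ∈ Submodule.span (L0 F σ) (Set.range (genericRep F hs)) := by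
    intro g v p hp q hq
    have hv : v ∈ Submodule.span (L0 F σ) (Set.range fun (x : L0 F σ) (g : G) => g • x) := by
      rw [span_range_orbit]; trivial
    induction hv using Submodule.span_induction with
    | mem v hv =>
      obtain ⟨x, rfl⟩ := hv
      refine Submodule.subset_span ⟨coeffHom σ _ _ x * q, ?_⟩
      rw [map_mul, genericRep_coeffHom, hq]
    | zero => simp
    | add v w _ _ hv hw =>
      have : Matrix.diagonal (v + w) = Matrix.diagonal v + Matrix.diagonal w :=
        (Matrix.diagonal_add v w).symm
      rw [this, add_mul]
      exact Submodule.add_mem _ hv hw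
    | smul c v _ hv =>
      rw [Matrix.diagonal_smul, Matrix.smul_mul]
      exact Submodule.smul_mem _ _ hv
  rw [eq_top_iff]
  intro M _
  rw [Matrix.matrix_eq_sum_single M]
  refine Submodule.sum_mem _ fun k _ => Submodule.sum_mem _ fun l _ => ?_
  obtain ⟨g, rfl⟩ : ∃ g, l = k * g := ⟨k⁻¹ * l, by rw [mul_inv_cancel_left]⟩
  obtain ⟨p, hp, q, hq⟩ := exists_genericRep_eq_monomial F hs hσ g
  have heq : Matrix.single k (k * g) (M k (k * g)) = Matrix.diagonal
      (Pi.single k (M k (k * g) * (e F σ ⟨_, monomial_mem hs hp k⟩)⁻¹)) *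
        monomial F hs p g hp := by
    ext a b
    rw [Matrix.diagonal_mul, Matrix.single_apply]
    simp only [monomial, Matrix.of_apply]
    by_cases hka : k = a
    · subst hka
      rw [Pi.single_eq_same]
      by_cases hlb : k * g = b
      · subst hlb
        rw [if_pos rfl, if_pos ⟨rfl, rfl⟩, mul_assoc, inv_mul_cancel₀ (e_ne_zero F _), mul_one]
      · rw [if_neg (Ne.symm hlb), mul_zero, if_neg (fun h => hlb h.2)]
    · rw [Pi.single_eq_of_ne (Ne.symm hka), zero_mul, if_neg (fun h => hka h.1)]
  rw [heq]
  exact key g _ p hp q hq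

lemma isTwistedForm_genericRep [FaithfulSMul G (L0 F σ)] (hσ : IsDirectProduct σ) :
    IsTwistedForm (A := GenericCrossedProduct F σ) (genericCocycle F hs) (genericRep F hs) where
  comm a h k g := genericRep_mem F hs a h k g
  span := span_range_genericRep F hs hσ
  finite := (finite_and_finrank_le_crossedProduct hσ fun _ => e_ne_zero F _).1
  finrank_le := (finite_and_finrank_le_crossedProduct hσ fun _ => e_ne_zero F _).2

end Model

/-- A finite-dimensional algebra without zero divisors is its own underlying division algebra. -/
lemma hasIndex_of_isDomain {K : Type v} [Field K] {A : Type w} [Ring A] [Algebra K A] [IsDomain A]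
    [FiniteDimensional K A] {m : ℕ} (hA : Module.finrank K A = m ^ 2) : HasIndex K A m :=
  ⟨A, divisionRingOfFiniteDimensional K A, ‹Algebra K A›, 1, one_ne_zero,
    ⟨{ toFun := fun a => Matrix.of fun _ _ => a
       invFun := fun M => M 0 0
       left_inv := fun a => rfl
       right_inv := fun M => by
        ext i j
        rw [Subsingleton.elim i 0, Subsingleton.elim j 0]
        rfl
       map_mul' := fun a b => by
        ext i j
        simp [Matrix.mul_apply]
       map_add' := fun a b => rfl
       commutes' := fun k => by
        ext i j
        rw [Matrix.algebraMap_matrix_apply, if_pos (Subsingleton.elim i j), Matrix.of_apply] }⟩,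
    ‹_›, hA⟩

end CrossedProd

end

/-! ### Exponent and index of the generic crossed product -/

theorem lemma3p5 {G : Type*} [CommGroup G] [Finite G] (hG : ¬ IsCyclic G)
    {r : ℕ} (σ : Fin r → G) (hσ : CrossedProd.IsDirectProduct σ)
    {F : Type*} [Field F] [MulSemiringAction G F] (hF : CrossedProd.UnitsH1Trivial G F) :
    Algebra.IsCentral (FixedPoints.subfield G (CrossedProd.L0 F σ))
        (CrossedProd.GenericCrossedProduct F σ) ∧
      IsSimpleRing (CrossedProd.GenericCrossedProduct F σ) ∧
      Module.finrank (FixedPoints.subfield G (CrossedProd.L0 F σ))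
        (CrossedProd.GenericCrossedProduct F σ) = Nat.card G ^ 2 ∧
      CrossedProd.HasExponent (FixedPoints.subfield G (CrossedProd.L0 F σ))
        (CrossedProd.GenericCrossedProduct F σ) (Nat.card G) ∧
      CrossedProd.HasIndex (FixedPoints.subfield G (CrossedProd.L0 F σ))
        (CrossedProd.GenericCrossedProduct F σ) (Nat.card G) := by
  classical
  have := Fintype.ofFinite G
  obtain ⟨s, hs1, hs⟩ := CrossedProd.exists_section hσ
  have := CrossedProd.faithfulSMul_L0 F hG hσ
  have ht := CrossedProd.isCocycle_genericCocycle F hs hs1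
  have hf := CrossedProd.isTwistedForm_genericRep F hs hσ
  have hfin := hf.finite
  have hdom := hf.isDomain ht fun w => CrossedProd.card_dvd_of_isCobdry F hs
  refine ⟨hf.isCentral ht, ?_, hf.finrank_eq, ⟨⟨Nat.card_pos, ?_⟩, ?_⟩,
    CrossedProd.hasIndex_of_isDomain hf.finrank_eq⟩
  -- A finite-dimensional domain over a field is a division ring, hence simple.
  · let _ := divisionRingOfFiniteDimensional (FixedPoints.subfield G (CrossedProd.L0 F σ))
      (CrossedProd.GenericCrossedProduct F σ)
    exact (inferInstance : IsSimpleRing (CrossedProd.GenericCrossedProduct F σ))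
  · exact hf.isSplit_of_isCobdry ht (CrossedProd.isCobdry_genericCocycle_pow_card F hs)
  · rintro m ⟨hm, hsplit⟩
    exact Nat.le_of_dvd hm (CrossedProd.card_dvd_of_isCobdry F hs (hf.isCobdry_of_isSplit ht hsplit))
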